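/- Let $N\ge 1$ be a square-free integer and put $$\Gamma_0(N)^+=\Big\{ e^{-1/2}\begin{pmatrix} a&b\\ c&d\end{pmatrix}\in \mathrm{SL}_2(\mathbb R):\ a,b,c,d,e\in\mathbb Z,\ ad-bc=e,\ e\mid N,\ e\mid a,\ e\mid d,\ N\mid c\Big\},$$ which acts on the upper half-plane $\mathbb H$ by Möbius transformations. Let $\Gamma_\infty(N)$ be the stabilizer of the cusp $i\infty$ in $\Gamma_0(N)^+$, i.e. the subgroup of elements with lower left entry $0$. For $z=x+iy\in\mathbb H$ and $s\in\mathbb C$ with $\operatorname{Re}(s)>1$ the series $$\mathcal E_\infty(z,s)=\sum_{\gamma\in\Gamma_\infty(N)\backslash\Gamma_0(N)^+}\operatorname{Im}(\gamma z)^s$$ converges absolutely and has the Fourier expansion $$\mathcal E_\infty(z,s)=y^s+\varphi_N(s)\,y^{1-s}+\sum_{m\in\mathbb Z,\ m\ne 0}\varphi_N(m,s)\,W_s(mz),$$ where the sum over $m$ converges absolutely. Here $$W_s(mz)=2\sqrt{|m|y}\;K_{s-1/2}(2\pi|m|y)\,e^{2\pi i m x},$$ $K_\nu$ is the modified Bessel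 function of the second kind, $K_\nu(t)=\frac12\int_0^\infty e^{-\frac t2(u+1/u)}u^{\nu-1}\,du$ for $t>0$, $$\varphi_N(s)=\frac{s}{s-1}\cdot\frac{\xi(2s-1)}{\xi(2s)}\cdot\prod_{p\mid N}\frac{p^{1-s}+1}{p^s+1},\qquad \xi(s)=\tfrac12 s(s-1)\pi^{-s/2}\Gamma(s/2)\zeta(s),$$ with the product over the primes dividing $N$, and, for $m\neq 0$, $$\varphi_N(m,s)=\pi^s\,\frac{|m|^{s-1}}{\Gamma(s)}\sum_{v\mid N}v^sN^{-2s}\sum_{n\ge1,\ (v,n)=1}\frac{a_m((N/v)n)}{n^{2s}},\qquad a_m(n)=\mu\Big(\frac{n}{(|m|,n)}\Big)\frac{\varphi(n)}{\varphi\big(n/(|m|,n)\big)},$$ where $v$ runs over the positive divisors of $N$, the Dirichlet series over $n$ converge absolutely, $(\cdot,\cdot)$ is the greatest common divisor, $\mu$ is the Möbius function and $\varphi$ (of a positive integer) is Euler's totient function. -/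

import Mathlib

open scoped UpperHalfPlane MatrixGroups

noncomputable section

namespace Moonshine

/-- `A ∈ SL₂(ℝ)` has the form `e^{-1/2} (a b; c d)` with integers `a, b, c, d, e` such that
`ad - bc = e`, `e ∣ N`, `e ∣ a`, `e ∣ d`, `N ∣ c`. (Necessarily `e > 0`, as `e^{-1/2}` is a
finite real number.) -/
def IsElement (N : ℕ) (A : SL(2, ℝ)) : Prop :=
  ∃ a b c d e : ℤ, 0 < e ∧ a * d - b * c = e ∧ e ∣ (N : ℤ) ∧ e ∣ a ∧ e ∣ d ∧ (N : ℤ) ∣ c ∧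
    (A : Matrix (Fin 2) (Fin 2) ℝ) =
      (Real.sqrt (e : ℝ))⁻¹ • !![(a : ℝ), (b : ℝ); (c : ℝ), (d : ℝ)]

theorem isElement_one (N : ℕ) : IsElement N 1 := by
  refine ⟨1, 0, 0, 1, 1, one_pos, by norm_num, one_dvd _, one_dvd _, one_dvd _, dvd_zero _, ?_⟩
  ext i j
  fin_cases i <;> fin_cases j <;> simp

theorem isElement_inv {N : ℕ} {A : SL(2, ℝ)} (hA : IsElement N A) : IsElement N A⁻¹ := by
  obtain ⟨a, b, c, d, e, he, hdet, heN, hea, hed, hc, hm⟩ := hA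
  refine ⟨d, -b, -c, a, e, he, by linarith, heN, hed, hea, (dvd_neg).2 hc, ?_⟩
  rw [Matrix.SpecialLinearGroup.coe_inv, hm, Matrix.adjugate_smul, Matrix.adjugate_fin_two]
  ext i j
  fin_cases i <;> fin_cases j <;> simp

theorem isElement_mul {N : ℕ} {A B : SL(2, ℝ)} (hA : IsElement N A) (hB : IsElement N B) :
    IsElement N (A * B) := by
  obtain ⟨a, b, c, d, e, he, hdet, heN, hea, hed, hc, hm⟩ := hA
  obtain ⟨a', b', c', d', f, hf, hdet', hfN, hfa, hfd, hc', hm'⟩ := hB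
  have hg : 0 < (Int.gcd e f : ℤ) := by
    exact_mod_cast Int.gcd_pos_of_ne_zero_left f he.ne'
  set g : ℤ := (Int.gcd e f : ℤ) with hgdef
  obtain ⟨e1, he1⟩ : g ∣ e := Int.gcd_dvd_left e f
  obtain ⟨f1, hf1⟩ : g ∣ f := Int.gcd_dvd_right e f
  have he1p : 0 < e1 := by
    by_contra h
    nlinarith
  have hf1p : 0 < f1 := by
    by_contra h
    nlinarith
  have hcop : IsCoprime e1 f1 := by
    have hb := Int.gcd_eq_gcd_ab e f
    rw [← hgdef] at hb
    refine ⟨Int.gcdA e f, Int.gcdB e f, ?_⟩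
    apply mul_left_cancel₀ hg.ne'
    calc g * (Int.gcdA e f * e1 + Int.gcdB e f * f1)
        = (g * e1) * Int.gcdA e f + (g * f1) * Int.gcdB e f := by ring
      _ = g * 1 := by rw [← he1, ← hf1, ← hb, mul_one]
  have hl : g * (e1 * f1) ∣ (N : ℤ) := by
    obtain ⟨x, hx⟩ := heN
    have h1 : g * f1 ∣ g * (e1 * x) := by
      rw [← hf1]
      refine hfN.trans (dvd_of_eq ?_)
      rw [hx, he1]
      ring
    have h2 : f1 ∣ x :=
      hcop.symm.dvd_of_dvd_mul_left ((mul_dvd_mul_iff_left hg.ne').1 h1)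
    obtain ⟨y, rfl⟩ := h2
    exact ⟨y, by rw [hx, he1]; ring⟩
  obtain ⟨n, hn⟩ := hl
  obtain ⟨p, hp⟩ := hea
  obtain ⟨q, hq⟩ := hed
  obtain ⟨k, hk⟩ := hc
  obtain ⟨p', hp'⟩ := hfa
  obtain ⟨q', hq'⟩ := hfd
  obtain ⟨k', hk'⟩ := hc'
  have hA11 : a * a' + b * c' = g * (e1 * f1 * (g * p * p' + b * n * k')) := by
    rw [hp, hp', hk', hn, he1, hf1]; ring
  have hA12 : a * b' + b * d' = g * (e1 * p * b' + b * f1 * q') := by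
    rw [hp, hq', he1, hf1]; ring
  have hA21 : c * a' + d * c' = g * (N * (k * f1 * p' + e1 * q * k')) := by
    rw [hk, hp', hq, hk', he1, hf1]; ring
  have hA22 : c * b' + d * d' = g * (e1 * f1 * (n * k * b' + g * q * q')) := by
    rw [hk, hq, hq', hn, he1, hf1]; ring
  refine ⟨e1 * f1 * (g * p * p' + b * n * k'), e1 * p * b' + b * f1 * q',
    N * (k * f1 * p' + e1 * q * k'), e1 * f1 * (n * k * b' + g * q * q'), e1 * f1,
    mul_pos he1p hf1p, ?_, ⟨g * n, by rw [hn]; ring⟩,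
    Dvd.intro _ rfl, Dvd.intro _ rfl, Dvd.intro _ rfl, ?_⟩
  · have hgg : g * g ≠ 0 := mul_ne_zero hg.ne' hg.ne'
    apply mul_left_cancel₀ hgg
    calc _ = (g * (e1 * f1 * (g * p * p' + b * n * k')))
            * (g * (e1 * f1 * (n * k * b' + g * q * q')))
          - (g * (e1 * p * b' + b * f1 * q'))
            * (g * (N * (k * f1 * p' + e1 * q * k'))) := by ring
      _ = (a * d - b * c) * (a' * d' - b' * c') := by
          rw [← hA11, ← hA12, ← hA21, ← hA22]; ring
      _ = g * g * (e1 * f1) := by rw [hdet, hdet', he1, hf1]; ring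
  · have hgR : (0 : ℝ) < (g : ℝ) := by exact_mod_cast hg
    have he1R : (0 : ℝ) < (e1 : ℝ) := by exact_mod_cast he1p
    have hsq : (Real.sqrt ((e1 * f1 : ℤ) : ℝ))⁻¹
        = (Real.sqrt (e : ℝ))⁻¹ * (Real.sqrt (f : ℝ))⁻¹ * g := by
      have hroot : Real.sqrt (e : ℝ) * Real.sqrt (f : ℝ)
          = g * Real.sqrt ((e1 * f1 : ℤ) : ℝ) := by
        rw [← Real.sqrt_mul (by exact_mod_cast he.le)]
        have : (e : ℝ) * f = (g : ℝ) ^ 2 * ((e1 * f1 : ℤ) : ℝ) := by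
          rw [he1, hf1]; push_cast; ring
        rw [this, Real.sqrt_mul (by positivity), Real.sqrt_sq hgR.le]
      rw [← mul_inv, hroot, mul_inv, mul_comm (g : ℝ)⁻¹, mul_assoc, inv_mul_cancel₀ hgR.ne',
        mul_one]
    rw [Matrix.SpecialLinearGroup.coe_mul, hm, hm', Matrix.smul_mul, Matrix.mul_smul, smul_smul,
      hsq, mul_smul _ (g : ℝ)]
    congr 1
    have r11 : (a : ℝ) * a' + b * c' = g * (e1 * f1 * (g * p * p' + b * n * k')) := by
      exact_mod_cast hA11
    have r12 : (a : ℝ) * b' + b * d' = g * (e1 * p * b' + b * f1 * q') := by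
      exact_mod_cast hA12
    have r21 : (c : ℝ) * a' + d * c' = g * (N * (k * f1 * p' + e1 * q * k')) := by
      exact_mod_cast hA21
    have r22 : (c : ℝ) * b' + d * d' = g * (e1 * f1 * (n * k * b' + g * q * q')) := by
      exact_mod_cast hA22
    ext i j
    fin_cases i <;> fin_cases j <;> simp [Matrix.mul_apply, Fin.sum_univ_two, r11, r12, r21, r22]

/-- The moonshine group `Γ₀(N)⁺` in `SL₂(ℝ)`. -/
def Gamma0Plus (N : ℕ) : Subgroup SL(2, ℝ) where
  carrier := {A | IsElement N A}
  one_mem' := isElement_one N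
  mul_mem' := isElement_mul
  inv_mem' := isElement_inv

/-- The parabolic subgroup `Γ_∞(N)` of `Γ₀(N)⁺`: the stabilizer of the cusp `i∞`, that is, the
elements with lower left entry `0`. -/
def GammaInf (N : ℕ) : Subgroup (Gamma0Plus N) where
  carrier := {A | (A : SL(2, ℝ)).1 1 0 = 0}
  one_mem' := by simp
  mul_mem' := by
    intro A B hA hB
    simp only [Set.mem_ofPred_eq] at hA hB ⊢
    simp [Matrix.mul_apply, Fin.sum_univ_two, hA, hB]
  inv_mem' := by
    intro A hA
    simp only [Set.mem_ofPred_eq] at hA ⊢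
    simp [Matrix.SpecialLinearGroup.coe_inv, Matrix.adjugate_fin_two, hA]

/-- The lower right entry of an element of `Γ_∞(N)` is `±1`. -/
theorem sq_eq_one_of_mem_GammaInf {N : ℕ} {A : Gamma0Plus N} (hA : A ∈ GammaInf N) :
    ((A : SL(2, ℝ)).1 1 1) ^ 2 = 1 := by
  obtain ⟨⟨a, b, c, d, e, he, hdet, heN, ⟨p, hp⟩, ⟨q, hq⟩, hc, hm⟩, h0⟩ := And.intro A.2 hA
  have heR : (0 : ℝ) < Real.sqrt (e : ℝ) := Real.sqrt_pos.2 (by exact_mod_cast he)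
  change (A : SL(2, ℝ)).1 1 0 = 0 at h0
  rw [hm] at h0
  have hc0 : c = 0 := by
    simpa [heR.ne'] using h0
  subst hc0
  have h1 : e * (p * q) = 1 := by
    apply mul_left_cancel₀ he.ne'
    calc e * (e * (p * q)) = (e * p) * (e * q) - b * 0 := by ring
      _ = e * 1 := by rw [← hp, ← hq, hdet, mul_one]
  have he1 : e = 1 := Int.eq_one_of_mul_eq_one_right he.le h1
  subst he1
  have hq1 : q ^ 2 = 1 := by
    have : IsUnit q := IsUnit.of_mul_eq_one (1 * p) (by linarith)
    rcases Int.isUnit_iff.1 this with h | h <;> simp [h]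
  rw [hm]
  have hdR : (d : ℝ) ^ 2 = 1 := by
    rw [hq, one_mul]; exact_mod_cast hq1
  simpa using hdR

theorem im_smul_eq_of_mem_GammaInf {N : ℕ} {A : Gamma0Plus N} (hA : A ∈ GammaInf N) (w : ℍ) :
    ((A : SL(2, ℝ)) • w).im = w.im := by
  have h2 := sq_eq_one_of_mem_GammaInf hA
  have h0 : (A : SL(2, ℝ)).1 1 0 = 0 := hA
  rw [MulAction.compHom_smul_def, UpperHalfPlane.im_smul_eq_div_normSq]
  have hden : Complex.normSq (UpperHalfPlane.denom
      (Matrix.SpecialLinearGroup.mapGL ℝ (A : SL(2, ℝ))) w) = 1 := by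
    simp [UpperHalfPlane.denom, h0, Complex.normSq_ofReal, ← sq, h2]
  rw [hden]
  simp

/-- The coset space `Γ_∞(N) \ Γ₀(N)⁺` (of right cosets `Γ_∞(N) γ`). -/
abbrev Cosets (N : ℕ) : Type := Quotient (QuotientGroup.rightRel (GammaInf N))

/-- The summand `Im(γ z)^s` as a function of the coset of `γ`. -/
def eisensteinTerm (N : ℕ) (z : ℍ) (s : ℂ) : Cosets N → ℂ :=
  Quotient.lift (fun γ : Gamma0Plus N => ((((γ : SL(2, ℝ)) • z).im : ℝ) : ℂ) ^ s) <| by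
    intro γ δ h
    have h' : δ * γ⁻¹ ∈ GammaInf N := QuotientGroup.rightRel_apply.1 h
    have := im_smul_eq_of_mem_GammaInf h' ((γ : SL(2, ℝ)) • z)
    rw [← mul_smul] at this
    simp only [Subgroup.coe_mul, Subgroup.coe_inv, inv_mul_cancel_right] at this
    simp only [this]

/-- The real analytic Eisenstein series
`𝓔_∞(z, s) = ∑_{γ ∈ Γ_∞(N) \ Γ₀(N)⁺} Im(γ z)^s`. -/
def eisenstein (N : ℕ) (z : ℍ) (s : ℂ) : ℂ := ∑' q : Cosets N, eisensteinTerm N z s q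

/-- The modified Bessel function of the second kind, for `y > 0` and `ν ∈ ℂ`:
`K_ν(y) = (1/2) ∫_0^∞ exp(-(y/2)(u + 1/u)) u^(ν-1) du`. -/
def besselK (ν : ℂ) (y : ℝ) : ℂ :=
  (1 / 2) * ∫ u in Set.Ioi (0 : ℝ), (Real.exp (-(y / 2) * (u + 1 / u)) : ℂ) * (u : ℂ) ^ (ν - 1)

/-- The Whittaker function
`W_s(mz) = 2 √(|m| y) K_{s-1/2}(2π |m| y) e(mx)`, where `z = x + iy` and `e(t) = exp(2πit)`. -/
def whittaker (s : ℂ) (m : ℤ) (z : ℍ) : ℂ :=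
  2 * (Real.sqrt (|(m : ℝ)| * z.im) : ℂ) * besselK (s - 1 / 2) (2 * Real.pi * |(m : ℝ)| * z.im) *
    Complex.exp (2 * Real.pi * Complex.I * (m * z.re))

/-- The completed Riemann zeta function `ξ(s) = ½ s (s-1) π^{-s/2} Γ(s/2) ζ(s)`. -/
def xi (s : ℂ) : ℂ :=
  1 / 2 * s * (s - 1) * (Real.pi : ℂ) ^ (-s / 2) * Complex.Gamma (s / 2) * riemannZeta s

/-- The scattering term `φ_N(s)`. -/
def scattering (N : ℕ) (s : ℂ) : ℂ :=
  s / (s - 1) * (xi (2 * s - 1) / xi (2 * s)) *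
    ∏ p ∈ N.primeFactors, ((p : ℂ) ^ (1 - s) + 1) / ((p : ℂ) ^ s + 1)

/-- `a_m(n) = μ(n / (|m|, n)) φ(n) / φ(n / (|m|, n))`, with the Möbius function and Euler's
totient function. -/
def ramanujanCoeff (m : ℤ) (n : ℕ) : ℂ :=
  (ArithmeticFunction.moebius (n / Nat.gcd m.natAbs n) : ℂ) *
    ((Nat.totient n : ℂ) / (Nat.totient (n / Nat.gcd m.natAbs n) : ℂ))

/-- The terms of the Dirichlet series `∑_{n ≥ 1, (v, n) = 1} a_m((N/v) n) / n^{2s}`. -/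
def dirichletTerm (N : ℕ) (m : ℤ) (s : ℂ) (v : ℕ) (n : {n : ℕ // 1 ≤ n ∧ Nat.Coprime v n}) : ℂ :=
  ramanujanCoeff m (N / v * n) / ((n : ℕ) : ℂ) ^ (2 * s)

/-- The Fourier coefficient `φ_N(m, s)`, for `m ≠ 0`. -/
def fourierCoeff (N : ℕ) (m : ℤ) (s : ℂ) : ℂ :=
  (Real.pi : ℂ) ^ s * (((|m| : ℤ) : ℂ) ^ (s - 1) / Complex.Gamma s) *
    ∑ v ∈ N.divisors, (v : ℂ) ^ s * (N : ℂ) ^ (-2 * s) *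
      ∑' n : {n : ℕ // 1 ≤ n ∧ Nat.Coprime v n}, dirichletTerm N m s v n

end Moonshine

end

/-! A coset of `Γ_∞(N)` is a lower row up to proportionality. Writing `c = N c'`, `d = e d'`, `N = e
f`, the lower row is `√e (f c', d')`, and dividing the determinant relation by `e` shows that `f c'`
and `d'` are coprime and that `e` is coprime to `f c'`. So the nontrivial cosets correspond to
coprime pairs `(q, d)` with `q > 0`, and `e = N/(N,q)` is determined by `q`. The corresponding
summand is `y^s (N/(N,q))^{-s} |qz+d|^{-2s}`.

Write `d = u + qk` with `u` a reduced residue mod `q`. The sum over `k` is a periodization of `(x² +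
y²)^{-s}` at `x + u/q`, to which Poisson summation applies (`tsum_sqAddSqCpow`). The sum of the
phases over `u` is a Ramanujan sum, equal to `a_m(q)` by Hölder's formula (`ramanujanSum_eq`). The
`m`-th coefficient is thus a Fourier transform times `∑_q (N/(N,q))^{-s} a_m(q) q^{-2s}`.

The Fourier transform is a Bessel function for `m ≠ 0` and a quotient of Gamma values for `m = 0`.
Substituting `q = (N/v) n` with `v = N/(N,q)` turns the series over `q` into the stated sum over `v
∣ N` (`sum_divisors_dirichletTerm`). For `m = 0` it is an Euler product (`tsum_mergedTerm_zero`),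
which yields the scattering term. -/

namespace Moonshine

/-! ### Ramanujan sums and Hölder's formula. -/

/-- The sum of the primitive `n`-th roots of unity is `μ(n)`. -/
theorem sum_primitiveRoots_eq_moebius {n : ℕ} (hn : 0 < n) :
    ∑ ζ ∈ primitiveRoots n ℂ, ζ = (ArithmeticFunction.moebius n : ℂ) := by
  -- Sorting the `n`-th roots of unity by exact order gives a divisor sum that vanishes for `n > 1`;
  -- Möbius inversion then isolates the primitive roots.
  have key : ∀ n > 0, ∑ i ∈ n.divisors, (∑ ζ ∈ primitiveRoots i ℂ, ζ)
      = if n = 1 then (1 : ℂ) else 0 := by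
    intro n hn
    have : NeZero n := ⟨hn.ne'⟩
    have hz := Complex.isPrimitiveRoot_exp n hn.ne'
    rw [← Finset.sum_biUnion, ← IsPrimitiveRoot.nthRoots_one_eq_biUnion_primitiveRoots]
    · split_ifs with h1
      · subst h1
        have h1 : Polynomial.nthRootsFinset 1 (1 : ℂ) = {1} := by
          ext x
          simp [Polynomial.mem_nthRootsFinset one_pos]
        rw [h1, Finset.sum_singleton]
      · have h2 : 1 < n := by omega
        rw [← hz.geom_sum_eq_zero h2]
        symm
        refine Finset.sum_bij (fun i _ => Complex.exp (2 * Real.pi * Complex.I / n) ^ i) ?_ ?_ ?_ ?_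
        · intro i _
          rw [Polynomial.mem_nthRootsFinset hn]
          rw [← pow_mul, mul_comm i n, pow_mul, hz.pow_eq_one, one_pow]
        · intro i hi j hj H
          exact hz.pow_inj (Finset.mem_range.1 hi) (Finset.mem_range.1 hj) H
        · intro ξ hξ
          rw [Polynomial.mem_nthRootsFinset hn] at hξ
          obtain ⟨i, hi, h⟩ := hz.eq_pow_of_pow_eq_one hξ
          exact ⟨i, Finset.mem_range.2 hi, h⟩
        · intro _ _; rfl
    · intro i _ j _ hij
      exact IsPrimitiveRoot.disjoint hij
  have := (ArithmeticFunction.sum_eq_iff_sum_mul_moebius_eq.1 key) n hn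
  rw [← this]
  rw [Nat.sum_divisorsAntidiagonal (fun a b => (ArithmeticFunction.moebius a : ℂ) *
    (if b = 1 then (1 : ℂ) else 0)), Finset.sum_eq_single n]
  · simp [Nat.div_self hn]
  · intro d hd hdn
    have hdvd := Nat.dvd_of_mem_divisors hd
    have : n / d ≠ 1 := by
      intro h
      have := Nat.div_mul_cancel hdvd
      rw [h, one_mul] at this
      exact hdn this
    simp [this]
  · intro h
    exact absurd (Nat.mem_divisors_self n hn.ne') h

theorem sum_units_pow_eq_moebius {n : ℕ} [NeZero n] {ζ : ℂ} (hζ : IsPrimitiveRoot ζ n) :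
    ∑ u : (ZMod n)ˣ, ζ ^ (u : ZMod n).val = (ArithmeticFunction.moebius n : ℂ) := by
  have hn : 0 < n := NeZero.pos n
  rw [← sum_primitiveRoots_eq_moebius hn]
  refine Finset.sum_bij (fun u _ => ζ ^ (u : ZMod n).val) ?_ ?_ ?_ ?_
  · intro u _
    rw [mem_primitiveRoots hn]
    exact hζ.pow_of_coprime _ (ZMod.val_coe_unit_coprime u)
  · intro u _ v _ H
    exact Units.ext (ZMod.val_injective n (hζ.pow_inj (ZMod.val_lt _) (ZMod.val_lt _) H))
  · intro ξ hξ
    rw [mem_primitiveRoots hn, hζ.isPrimitiveRoot_iff] at hξ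
    obtain ⟨i, hin, hi, H⟩ := hξ
    refine ⟨ZMod.unitOfCoprime i hi, Finset.mem_univ _, ?_⟩
    simpa [ZMod.val_natCast, Nat.mod_eq_of_lt hin] using H
  · intro _ _; rfl

/-- The Ramanujan sum `∑ e(m u / q)` over the reduced residues `u` modulo `q`. -/
noncomputable def ramanujanSum (q : ℕ) [NeZero q] (m : ℤ) : ℂ :=
  ∑ u : (ZMod q)ˣ, Complex.exp (2 * Real.pi * Complex.I * (m / q)) ^ (u : ZMod q).val

/-- **Hölder's formula** for the Ramanujan sum. -/
theorem ramanujanSum_eq (q : ℕ) [NeZero q] (m : ℤ) :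
    ramanujanSum q m = ramanujanCoeff m q := by
  have hq : 0 < q := NeZero.pos q
  have hg : 0 < Nat.gcd m.natAbs q := Nat.gcd_pos_of_pos_right _ hq
  obtain ⟨q', hq'⟩ := Nat.gcd_dvd_right m.natAbs q
  obtain ⟨m', hm'⟩ : ((Nat.gcd m.natAbs q : ℕ) : ℤ) ∣ m :=
    Int.natCast_dvd.2 (Nat.gcd_dvd_left m.natAbs q)
  unfold ramanujanSum ramanujanCoeff
  set g := Nat.gcd m.natAbs q with hgdef
  have hq'pos : 0 < q' := Nat.pos_of_ne_zero (by rintro rfl; omega)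
  have : NeZero q' := ⟨hq'pos.ne'⟩
  have hdiv : q / g = q' := by
    conv_lhs => rw [hq']
    exact Nat.mul_div_cancel_left _ hg
  rw [hdiv]
  have hcop : IsCoprime m' (q' : ℤ) := by
    rw [Int.isCoprime_iff_gcd_eq_one]
    have h1 : Int.gcd m q = g := by simp [Int.gcd, hgdef]
    have h2 : Int.gcd m q = g * Int.gcd m' q' := by
      conv_lhs => rw [hm', hq']
      push_cast
      rw [Int.gcd_mul_left]; simp
    have : g * Int.gcd m' q' = g * 1 := by rw [← h2, h1, mul_one]
    exact Nat.eq_of_mul_eq_mul_left hg this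
  have hratio : ((m : ℂ) / q) = m' / q' := by
    conv_lhs => rw [hm', hq']
    push_cast
    rw [mul_div_mul_left]
    exact_mod_cast hg.ne'
  rw [hratio]
  have hζ := Complex.isPrimitiveRoot_exp_of_isCoprime m' q' hq'pos.ne' hcop
  set ζ := Complex.exp (2 * Real.pi * Complex.I * (m' / q'))
  have hdvd : q' ∣ q := ⟨g, by rw [mul_comm]; exact hq'⟩
  have hsurj := ZMod.unitsMap_surjective hdvd
  -- In lowest terms `m/q = m'/q'`, so the summand depends only on `u` mod `q'`. Reduction of units
  -- is surjective with fibres of equal size `c`.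
  have hval : ∀ u : (ZMod q)ˣ,
      ζ ^ (u : ZMod q).val = ζ ^ ((ZMod.unitsMap hdvd u : (ZMod q')ˣ) : ZMod q').val := by
    intro u
    have : ((ZMod.unitsMap hdvd u : (ZMod q')ˣ) : ZMod q').val = (u : ZMod q).val % q' := by
      rw [ZMod.unitsMap_val, ZMod.cast_eq_val, ZMod.val_natCast]
    rw [this, ← pow_eq_pow_mod _ hζ.pow_eq_one]
  simp_rw [hval]
  have hfib : ∀ w : (ZMod q')ˣ, (Finset.univ.filter fun u => ZMod.unitsMap hdvd u = w).card
      = (Finset.univ.filter fun u => ZMod.unitsMap hdvd u = 1).card := fun w =>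
    MonoidHom.card_fiber_eq_of_mem_range _ (hsurj w) (hsurj 1)
  set c := (Finset.univ.filter fun u => ZMod.unitsMap hdvd u = 1).card
  have hsum : ∀ F : (ZMod q')ˣ → ℂ,
      ∑ u : (ZMod q)ˣ, F (ZMod.unitsMap hdvd u) = c * ∑ w, F w := by
    intro F
    rw [← Finset.sum_fiberwise Finset.univ (ZMod.unitsMap hdvd), Finset.mul_sum]
    refine Finset.sum_congr rfl fun w _ => ?_
    rw [Finset.sum_congr rfl (g := fun _ => F w), Finset.sum_const, hfib w, nsmul_eq_mul]
    intro u hu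
    rw [(Finset.mem_filter.1 hu).2]
  -- The constant function identifies the fibre size: `φ(q) = c φ(q')`.
  have hcard := hsum fun _ => 1
  simp only [Finset.sum_const, Finset.card_univ, ZMod.card_units_eq_totient, nsmul_eq_mul,
    mul_one] at hcard
  rw [hsum (fun w => ζ ^ (w : ZMod q').val), sum_units_pow_eq_moebius hζ, hcard,
    mul_div_cancel_right₀, mul_comm]
  exact_mod_cast (Nat.totient_pos.2 hq'pos).ne'

/-- As a Ramanujan sum, the coefficient has `φ(q)` unimodular terms. The bound is uniform in `m`,
which later allows the sums over `q` and `m` to be exchanged. -/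
theorem norm_ramanujanCoeff_le (m : ℤ) {q : ℕ} (hq : 0 < q) : ‖ramanujanCoeff m q‖ ≤ q := by
  have : NeZero q := ⟨hq.ne'⟩
  rw [← ramanujanSum_eq]
  refine (norm_sum_le _ _).trans ?_
  have h1 : ‖Complex.exp (2 * Real.pi * Complex.I * (m / q))‖ = 1 := by
    rw [show 2 * (Real.pi : ℂ) * Complex.I * (m / q) = ((2 * Real.pi * (m / q) : ℝ) : ℂ) * Complex.I
      by push_cast; ring]
    exact Complex.norm_exp_ofReal_mul_I _
  simp only [norm_pow, h1, one_pow, Finset.sum_const, Finset.card_univ,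
    ZMod.card_units_eq_totient, nsmul_eq_mul, mul_one]
  exact_mod_cast Nat.totient_le q

theorem ramanujanCoeff_zero {q : ℕ} (hq : 0 < q) : ramanujanCoeff 0 q = Nat.totient q := by
  simp [ramanujanCoeff, Nat.div_self hq]

end Moonshine

/-! ### Merging the Dirichlet series, and the Euler product at `m = 0`. -/

namespace Moonshine

/-- The terms of the Dirichlet series obtained by merging all the pairs `(v, n)` with `v ∣ N`
and `n` coprime to `v` into the single variable `q = (N / v) n`. -/
noncomputable def mergedTerm (N : ℕ) (m : ℤ) (s : ℂ) (q : ℕ) : ℂ :=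
  ((N / N.gcd q : ℕ) : ℂ) ^ (-s) * (ramanujanCoeff m q / (q : ℂ) ^ (2 * s))

theorem norm_ramanujanCoeff_div_le (m : ℤ) (s : ℂ) {q : ℕ} (hq : 0 < q) :
    ‖ramanujanCoeff m q / (q : ℂ) ^ (2 * s)‖ ≤ (q : ℝ) ^ (1 - 2 * s.re) := by
  have hq' : (0 : ℝ) < q := by exact_mod_cast hq
  rw [norm_div, Complex.norm_natCast_cpow_of_pos hq, Real.rpow_sub hq', Real.rpow_one]
  have : (2 * s).re = 2 * s.re := by simp
  rw [this]
  gcongr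
  exact norm_ramanujanCoeff_le m hq

theorem norm_natCast_cpow_neg_le_one (n : ℕ) {s : ℂ} (hs : 0 < s.re) : ‖(n : ℂ) ^ (-s)‖ ≤ 1 := by
  rcases Nat.eq_zero_or_pos n with rfl | hn
  · rw [Nat.cast_zero, Complex.zero_cpow (by intro h; simp [neg_eq_zero.1 h] at hs)]
    simp
  · rw [Complex.norm_natCast_cpow_of_pos hn]
    exact Real.rpow_le_one_of_one_le_of_nonpos (by exact_mod_cast hn) (by simpa using hs.le)

theorem norm_mergedTerm_le (N : ℕ) (m : ℤ) {s : ℂ} (hs : 1 < s.re) (q : ℕ) :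
    ‖mergedTerm N m s q‖ ≤ (q : ℝ) ^ (1 - 2 * s.re) := by
  -- At `q = 0` the term is a division by `0 ^ (2 * s) = 0`, hence zero. The right side is also zero
  -- there, so the bound itself later shows that `q = 0` contributes nothing.
  rcases Nat.eq_zero_or_pos q with rfl | hq
  · have : (2 * s) ≠ 0 := by
      intro h
      have := congrArg Complex.re h
      simp at this
      linarith
    simp only [mergedTerm, Nat.cast_zero, Complex.zero_cpow this, div_zero, mul_zero, norm_zero]
    exact Real.rpow_nonneg le_rfl _
  · rw [mergedTerm, norm_mul]
    calc _ ≤ 1 * (q : ℝ) ^ (1 - 2 * s.re) :=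
          mul_le_mul (norm_natCast_cpow_neg_le_one _ (by linarith))
            (norm_ramanujanCoeff_div_le m s hq) (norm_nonneg _) zero_le_one
      _ = _ := one_mul _

theorem summable_natCast_rpow_one_sub {σ : ℝ} (hs : 1 < σ) :
    Summable fun q : ℕ => (q : ℝ) ^ (1 - 2 * σ) :=
  Real.summable_nat_rpow.2 (by linarith)

theorem summable_norm_mergedTerm (N : ℕ) (m : ℤ) {s : ℂ} (hs : 1 < s.re) :
    Summable fun q => ‖mergedTerm N m s q‖ :=
  (summable_natCast_rpow_one_sub hs).of_nonneg_of_le (fun _ => norm_nonneg _)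
    (norm_mergedTerm_le N m hs)

theorem gcd_div_mul_eq {N v n : ℕ} (hN : Squarefree N) (hv : v ∣ N) (h : v.Coprime n) :
    N.gcd (N / v * n) = N / v := by
  obtain ⟨w, rfl⟩ := hv
  have hv0 : 0 < v := Nat.pos_of_ne_zero (by rintro rfl; simp at hN)
  rw [Nat.mul_div_cancel_left _ hv0, mul_comm v w, Nat.gcd_mul_left, h, mul_one]

theorem div_gcd_eq {N v n : ℕ} (hN : Squarefree N) (hv : v ∣ N) (h : v.Coprime n) :
    N / N.gcd (N / v * n) = v := by
  rw [gcd_div_mul_eq hN hv h, Nat.div_div_self hv hN.ne_zero]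

/-- For `v ∣ N`, `n` coprime to `v`, the pairs `(v, n)` correspond to the positive integers
`q = (N / v) n`. -/
def mergePair (N : ℕ) (x : Σ v : N.divisors, {n : ℕ // 1 ≤ n ∧ Nat.Coprime v n}) : ℕ :=
  N / x.1 * x.2

theorem mergePair_injective {N : ℕ} (hN : Squarefree N) : Function.Injective (mergePair N) := by
  rintro ⟨⟨v, hv⟩, ⟨n, hn, hvn⟩⟩ ⟨⟨w, hw⟩, ⟨k, hk, hwk⟩⟩ h
  simp only [mergePair] at h hvn hwk
  have hv' := Nat.dvd_of_mem_divisors hv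
  have hvw : v = w := by
    rw [← div_gcd_eq hN hv' hvn, h, div_gcd_eq hN (Nat.dvd_of_mem_divisors hw) hwk]
  subst hvw
  have := Nat.eq_of_mul_eq_mul_left
    (Nat.div_pos (Nat.le_of_dvd hN.ne_zero.bot_lt hv') (Nat.pos_of_mem_divisors hv)) h
  subst this
  rfl

/-- The preimage of `q` is `v = N/(N,q)`, `n = q/(N,q)`; these are coprime, being the cofactors of a
gcd. -/
theorem range_mergePair {N : ℕ} (hN : Squarefree N) : Set.range (mergePair N) = {q | 0 < q} := by
  ext q
  constructor
  · rintro ⟨⟨⟨v, hv⟩, ⟨n, hn, hvn⟩⟩, rfl⟩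
    exact Nat.mul_pos (Nat.div_pos (Nat.le_of_dvd hN.ne_zero.bot_lt (Nat.dvd_of_mem_divisors hv))
      (Nat.pos_of_mem_divisors hv)) hn
  · intro hq
    have hg : 0 < N.gcd q := Nat.gcd_pos_of_pos_right _ hq
    have hgq := Nat.gcd_dvd_right N q
    refine ⟨⟨⟨N / N.gcd q, ?_⟩, ⟨q / N.gcd q, ?_, ?_⟩⟩, ?_⟩
    · exact Nat.mem_divisors.2 ⟨Nat.div_dvd_of_dvd (Nat.gcd_dvd_left _ _), hN.ne_zero⟩
    · exact Nat.div_pos (Nat.le_of_dvd hq hgq) hg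
    · exact Nat.coprime_div_gcd_div_gcd hg
    · simp only [mergePair]
      rw [Nat.div_div_self (Nat.gcd_dvd_left _ _) hN.ne_zero, Nat.mul_div_cancel' hgq]

theorem mergedTerm_mergePair {N : ℕ} (hN : Squarefree N) (m : ℤ) (s : ℂ)
    (v : N.divisors) (n : {n : ℕ // 1 ≤ n ∧ Nat.Coprime v n}) :
    mergedTerm N m s (mergePair N ⟨v, n⟩) =
      ((v : ℕ) : ℂ) ^ s * (N : ℂ) ^ (-2 * s) * dirichletTerm N m s v n := by
  obtain ⟨v, hv⟩ := v
  obtain ⟨n, hn, hvn⟩ := n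
  have hv' := Nat.dvd_of_mem_divisors hv
  have hv0 : ((v : ℕ) : ℂ) ≠ 0 := by exact_mod_cast (Nat.pos_of_mem_divisors hv).ne'
  simp only [mergedTerm, mergePair, dirichletTerm]
  simp only at hvn
  rw [div_gcd_eq hN hv' hvn]
  have h1 : (N : ℂ) ^ (-2 * s) = (v : ℂ) ^ (-2 * s) * ((N / v : ℕ) : ℂ) ^ (-2 * s) := by
    rw [← Complex.natCast_mul_natCast_cpow]
    congr 1
    exact_mod_cast (Nat.mul_div_cancel' hv').symm
  have h2 : ((N / v * n : ℕ) : ℂ) ^ (2 * s) = ((N / v : ℕ) : ℂ) ^ (2 * s) * (n : ℂ) ^ (2 * s) := by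
    rw [Nat.cast_mul, Complex.natCast_mul_natCast_cpow]
  have h3 : (v : ℂ) ^ (-s) = (v : ℂ) ^ s * (v : ℂ) ^ (-2 * s) := by
    rw [← Complex.cpow_add _ _ hv0]; ring_nf
  rw [h1, h2, h3, show (-2 : ℂ) * s = -(2 * s) by ring, Complex.cpow_neg (((N / v : ℕ) : ℂ))]
  simp only [div_eq_mul_inv, mul_inv]
  ring

/-- Up to a nonzero constant, this series is the fibre over `v` of the absolutely convergent merged
series. -/
theorem summable_dirichletTerm (N : ℕ) (hN : Squarefree N) (m : ℤ) {s : ℂ} (hs : 1 < s.re)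
    {v : ℕ} (hv : v ∈ N.divisors) :
    Summable fun n : {n : ℕ // 1 ≤ n ∧ Nat.Coprime v n} => dirichletTerm N m s v n := by
  have h := (((summable_norm_mergedTerm N m hs).of_norm).comp_injective
    (mergePair_injective hN)).sigma_factor (⟨v, hv⟩ : N.divisors)
  simp only [Function.comp_def, mergedTerm_mergePair hN] at h
  refine (summable_mul_left_iff ?_).1 h
  have hv0 : (v : ℂ) ≠ 0 := by exact_mod_cast (Nat.pos_of_mem_divisors hv).ne'
  have hN0 : (N : ℂ) ≠ 0 := by exact_mod_cast hN.ne_zero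
  simp [Complex.cpow_eq_zero_iff, hv0, hN0]

theorem sum_divisors_dirichletTerm {N : ℕ} (hN : Squarefree N) (m : ℤ) {s : ℂ} (hs : 1 < s.re) :
    ∑ v ∈ N.divisors, (v : ℂ) ^ s * (N : ℂ) ^ (-2 * s) *
      ∑' n : {n : ℕ // 1 ≤ n ∧ Nat.Coprime v n}, dirichletTerm N m s v n =
      ∑' q, mergedTerm N m s q := by
  have hsum := (summable_norm_mergedTerm N m hs).of_norm
  have hsupp : Function.support (mergedTerm N m s) ⊆ Set.range (mergePair N) := by
    rw [range_mergePair hN]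
    intro q hq
    refine Nat.pos_of_ne_zero ?_
    rintro rfl
    apply hq
    have := norm_mergedTerm_le N m hs 0
    rw [Nat.cast_zero, Real.zero_rpow (by linarith)] at this
    exact norm_le_zero_iff.1 this
  rw [← (mergePair_injective hN).tsum_eq hsupp,
    Summable.tsum_sigma (f := fun x => mergedTerm N m s (mergePair N x))
      (hsum.comp_injective (mergePair_injective hN)), tsum_fintype,
    ← Finset.sum_coe_sort]
  refine Finset.sum_congr rfl fun v _ => ?_
  rw [← tsum_mul_left]
  exact tsum_congr fun n => (mergedTerm_mergePair hN m s v n).symm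

/-- The multiplicative function `q ↦ (N, q)^s φ(q) q^{-2s}`. -/
noncomputable def gcdTotientTerm (N : ℕ) (s : ℂ) (q : ℕ) : ℂ :=
  (N.gcd q : ℂ) ^ s * (Nat.totient q / (q : ℂ) ^ (2 * s))

/-- Extracting `N^{-s}` leaves a multiplicative function of `q`, ready for an Euler product. -/
theorem mergedTerm_zero (N : ℕ) (s : ℂ) (q : ℕ) :
    mergedTerm N 0 s q = (N : ℂ) ^ (-s) * gcdTotientTerm N s q := by
  rcases Nat.eq_zero_or_pos q with rfl | hq
  · simp [mergedTerm, gcdTotientTerm, ramanujanCoeff]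
  have hg : 0 < N.gcd q := Nat.gcd_pos_of_pos_right _ hq
  have hg0 : ((N.gcd q : ℕ) : ℂ) ≠ 0 := by exact_mod_cast hg.ne'
  rw [mergedTerm, gcdTotientTerm, ramanujanCoeff_zero hq, ← mul_assoc]
  congr 1
  have : (N : ℂ) ^ (-s) = ((N / N.gcd q : ℕ) : ℂ) ^ (-s) * (N.gcd q : ℂ) ^ (-s) := by
    rw [← Complex.natCast_mul_natCast_cpow]
    congr 1
    exact_mod_cast (Nat.div_mul_cancel (Nat.gcd_dvd_left N q)).symm
  rw [this, mul_assoc, ← Complex.cpow_add _ _ hg0, neg_add_cancel, Complex.cpow_zero, mul_one]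

theorem natCast_prod_cpow (S : Finset ℕ) (s : ℂ) :
    ((∏ p ∈ S, p : ℕ) : ℂ) ^ s = ∏ p ∈ S, (p : ℂ) ^ s := by
  induction S using Finset.induction_on with
  | empty => simp
  | insert a S ha ih =>
    rw [Finset.prod_insert ha, Finset.prod_insert ha, Nat.cast_mul,
      Complex.natCast_mul_natCast_cpow, ih]

theorem gcd_prime_pow_succ {N p : ℕ} (hN : Squarefree N) (hp : p.Prime) (k : ℕ) :
    N.gcd (p ^ (k + 1)) = if p ∣ N then p else 1 := by
  split_ifs with h
  · obtain ⟨w, rfl⟩ := h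
    have hc : Nat.Coprime p w := Nat.coprime_of_squarefree_mul hN
    rw [pow_succ', Nat.gcd_mul_left, Nat.Coprime.pow_right _ hc.symm, mul_one]
  · exact Nat.Coprime.pow_right _ ((Nat.Prime.coprime_iff_not_dvd hp).2 h).symm

/-- The local Euler factor. For squarefree `N`, `(N, p^{k+1})` does not depend on `k`, so with `u =
p^s` the series beyond its first term is geometric of ratio `p/u²`. The factor of `ζ(2s)` is kept on
the left to avoid dividing infinite products. -/
theorem tsum_gcdTotientTerm_prime_pow {N : ℕ} (hN : Squarefree N) {s : ℂ} (hs : 1 < s.re)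
    {p : ℕ} (hp : p.Prime) :
    (∑' e, gcdTotientTerm N s (p ^ e)) * (1 - (p : ℂ) ^ (-(2 * s)))⁻¹ =
      (1 - (p : ℂ) ^ (-(2 * s - 1)))⁻¹ *
        (if p ∣ N then (p : ℂ) ^ s * (((p : ℂ) ^ (1 - s) + 1) / ((p : ℂ) ^ s + 1)) else 1) := by
  have hp0 : (p : ℂ) ≠ 0 := by exact_mod_cast hp.ne_zero
  have hp1 : (1 : ℝ) < p := by exact_mod_cast hp.one_lt
  set u : ℂ := (p : ℂ) ^ s with hu
  have hu0 : u ≠ 0 := by simp [hu, Complex.cpow_eq_zero_iff, hp0]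
  have hunorm : (p : ℝ) < ‖u‖ := by
    rw [hu, Complex.norm_natCast_cpow_of_pos hp.pos]
    simpa using Real.rpow_lt_rpow_of_exponent_lt hp1 hs
  have h2s : (p : ℂ) ^ (2 * s) = u ^ 2 := by
    rw [hu, mul_comm, Complex.cpow_mul_ofNat]
  have h1s : (p : ℂ) ^ (1 - s) = p / u := by
    rw [Complex.cpow_sub _ _ hp0, Complex.cpow_one]
  have hA : (p : ℂ) ^ (-(2 * s)) = (u ^ 2)⁻¹ := by rw [Complex.cpow_neg, h2s]
  have hB : (p : ℂ) ^ (-(2 * s - 1)) = p * (u ^ 2)⁻¹ := by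
    rw [neg_sub, Complex.cpow_sub _ _ hp0, Complex.cpow_one, h2s, div_eq_mul_inv]
  set c : ℂ := if p ∣ N then u else 1 with hc
  have hr : ‖(p : ℂ) * (u ^ 2)⁻¹‖ < 1 := by
    rw [norm_mul, norm_inv, norm_pow, Complex.norm_natCast, ← div_eq_mul_inv, div_lt_one]
    · nlinarith
    · positivity
  have hterm : ∀ k, gcdTotientTerm N s (p ^ (k + 1)) =
      c * (p - 1) * (u ^ 2)⁻¹ * (p * (u ^ 2)⁻¹) ^ k := by
    intro k
    have e1 : ((N.gcd (p ^ (k + 1)) : ℕ) : ℂ) ^ s = c := by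
      rw [gcd_prime_pow_succ hN hp, hc]
      split_ifs
      · rfl
      · simp
    have e2 : ((p ^ (k + 1) : ℕ) : ℂ) ^ (2 * s) = (u ^ 2) ^ (k + 1) := by
      rw [← h2s, Nat.cast_pow, ← Complex.natCast_cpow_natCast_mul, mul_comm,
        Complex.cpow_mul_nat]
    rw [gcdTotientTerm, e1, e2, Nat.totient_prime_pow_succ hp, Nat.cast_mul, Nat.cast_sub hp.one_le]
    push_cast
    rw [pow_succ, mul_pow, inv_pow]
    field_simp
  have hsum : HasSum (fun e => gcdTotientTerm N s (p ^ e))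
      (1 + c * (p - 1) * (u ^ 2)⁻¹ * (1 - p * (u ^ 2)⁻¹)⁻¹) := by
    have := (hasSum_geometric_of_norm_lt_one hr).mul_left (c * (p - 1) * (u ^ 2)⁻¹)
    simp_rw [← hterm] at this
    have h0 : gcdTotientTerm N s 1 = 1 := by simp [gcdTotientTerm]
    refine (hasSum_nat_add_iff' (f := fun e => gcdTotientTerm N s (p ^ e)) 1).1 ?_
    simpa [h0] using this
  rw [hsum.tsum_eq, hA, hB, h1s]
  have hne1 : u ^ 2 - p ≠ 0 := by
    intro h
    have : (p : ℂ) * (u ^ 2)⁻¹ = 1 := by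
      rw [← sub_eq_zero.1 h, mul_inv_cancel₀ (pow_ne_zero 2 hu0)]
    rw [this] at hr
    simp at hr
  have hne2 : u + 1 ≠ 0 := by
    intro h
    rw [eq_neg_of_add_eq_zero_left h] at hunorm
    simp at hunorm
    exact hp.ne_zero hunorm
  have hne3 : u - 1 ≠ 0 := by
    intro h
    rw [sub_eq_zero.1 h] at hunorm
    simp at hunorm
    exact hp.ne_zero hunorm
  have i1 : (1 - (u ^ 2)⁻¹) = (u - 1) * (u + 1) / u ^ 2 := by
    field_simp
    ring
  have i2 : (1 - p * (u ^ 2)⁻¹) = (u ^ 2 - p) / u ^ 2 := by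
    field_simp
  rw [i1, i2, hc]
  split_ifs
  · field_simp
    ring
  · field_simp
    ring

theorem tsum_mergedTerm_zero {N : ℕ} (hN : Squarefree N) {s : ℂ} (hs : 1 < s.re) :
    ∑' q, mergedTerm N 0 s q = riemannZeta (2 * s - 1) / riemannZeta (2 * s) *
      ∏ p ∈ N.primeFactors, ((p : ℂ) ^ (1 - s) + 1) / ((p : ℂ) ^ s + 1) := by
  have hN0 : (N : ℂ) ≠ 0 := by exact_mod_cast hN.ne_zero
  have hNs : (N : ℂ) ^ (-s) ≠ 0 := by simp [Complex.cpow_eq_zero_iff, hN0]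
  have h2s : 1 < (2 * s).re := by simp; linarith
  have h2s1 : 1 < (2 * s - 1).re := by simp; linarith
  have hsum : Summable fun q => ‖gcdTotientTerm N s q‖ := by
    have := summable_norm_mergedTerm N 0 hs
    simp_rw [mergedTerm_zero, norm_mul] at this
    exact (summable_mul_left_iff (norm_ne_zero_iff.2 hNs)).1 this
  have hE := EulerProduct.eulerProduct_hasProd (f := gcdTotientTerm N s) (by simp [gcdTotientTerm])
    (by
      intro a b hab
      simp only [gcdTotientTerm]
      rw [hab.gcd_mul, Nat.totient_mul hab]
      push_cast
      rw [Complex.natCast_mul_natCast_cpow, Complex.natCast_mul_natCast_cpow, mul_div_mul_comm]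
      ring) hsum (by simp [gcdTotientTerm])
  have hz := riemannZeta_eulerProduct_hasProd h2s
  have hz1 := riemannZeta_eulerProduct_hasProd h2s1
  -- The finite product over `p ∣ N` is viewed as a product over all primes, so that it multiplies
  -- the Euler product of `ζ(2s-1)` termwise.
  have hfin : HasProd (fun p : {p : ℕ // p.Prime} =>
      if (p : ℕ) ∣ N then ((p : ℕ) : ℂ) ^ s *
        ((((p : ℕ) : ℂ) ^ (1 - s) + 1) / (((p : ℕ) : ℂ) ^ s + 1)) else 1)
      (∏ p ∈ N.primeFactors, (p : ℂ) ^ s * (((p : ℂ) ^ (1 - s) + 1) / ((p : ℂ) ^ s + 1))) := by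
    have := hasProd_prod_of_ne_finset_one (f := fun p : {p : ℕ // p.Prime} =>
      if (p : ℕ) ∣ N then ((p : ℕ) : ℂ) ^ s *
        ((((p : ℕ) : ℂ) ^ (1 - s) + 1) / (((p : ℕ) : ℂ) ^ s + 1)) else 1)
      (s := N.primeFactors.subtype Nat.Prime) (L := SummationFilter.unconditional _) (by
        intro p hp
        rw [if_neg]
        intro h
        exact hp (by simp [p.2, h, hN.ne_zero]))
    convert this using 1
    rw [Finset.prod_subtype_of_mem (fun p : ℕ => if p ∣ N then (p : ℂ) ^ s *
        (((p : ℂ) ^ (1 - s) + 1) / ((p : ℂ) ^ s + 1)) else 1)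
        (fun p hp => Nat.prime_of_mem_primeFactors hp)]
    exact Finset.prod_congr rfl fun p hp => (if_pos (Nat.dvd_of_mem_primeFactors hp)).symm
  have hl := hE.mul hz
  have hr := hz1.mul (β := Nat.Primes) hfin
  have := hl.unique (by
    convert hr using 2 with p
    exact tsum_gcdTotientTerm_prime_pow hN hs p.2)
  have hzne : riemannZeta (2 * s) ≠ 0 := riemannZeta_ne_zero_of_one_lt_re h2s
  -- The local factors `p^s` multiply to `N^s`, which cancels the `N^{-s}` extracted earlier.
  rw [Finset.prod_mul_distrib, ← natCast_prod_cpow, Nat.prod_primeFactors_of_squarefree hN] at this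
  simp_rw [mergedTerm_zero]
  rw [tsum_mul_left, eq_div_of_mul_eq hzne this, Complex.cpow_neg]
  have hNs' : (N : ℂ) ^ s ≠ 0 := by simp [Complex.cpow_eq_zero_iff, hN0]
  field_simp

end Moonshine

/-! ### The Fourier transform of `(x² + y²)^{-s}` and Poisson summation. -/

namespace Moonshine

open MeasureTheory Set FourierTransform

/-- The function `x ↦ (x² + y²)^{-s}`. -/
noncomputable def sqAddSqCpow (s : ℂ) (y x : ℝ) : ℂ := ((x ^ 2 + y ^ 2 : ℝ) : ℂ) ^ (-s)

/-- The Bessel type integral `∫_0^∞ t^{s-3/2} exp(-(t y² + π² ξ² / t)) dt`. -/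
noncomputable def besselIntegral (s : ℂ) (y ξ : ℝ) : ℂ :=
  ∫ t in Ioi (0 : ℝ), (t : ℂ) ^ (s - 3 / 2) *
    (Real.exp (-(t * y ^ 2 + Real.pi ^ 2 * ξ ^ 2 / t)) : ℂ)

theorem integrableOn_rpow_mul_exp {a b : ℝ} (ha : -1 < a) (hb : 0 < b) :
    IntegrableOn (fun t : ℝ => t ^ a * Real.exp (-(t * b))) (Ioi 0) := by
  refine (integrableOn_rpow_mul_exp_neg_mul_rpow (p := 1) ha one_pos hb).congr_fun ?_
    measurableSet_Ioi
  intro t _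
  simp only [Real.rpow_one]
  ring_nf

theorem measurable_ofReal_cpow (a : ℂ) : Measurable fun t : ℝ => (t : ℂ) ^ a :=
  Complex.measurable_ofReal.pow_const a

/-- The joint integrand for the Fourier transform of `(x² + y²)^{-s}`. -/
noncomputable def fourierIntegrand (s : ℂ) (y ξ x t : ℝ) : ℂ :=
  Complex.exp (((-2 * Real.pi * x * ξ : ℝ) : ℂ) * Complex.I) *
    ((t : ℂ) ^ (s - 1) * (Real.exp (-(t * (x ^ 2 + y ^ 2))) : ℂ))

theorem norm_fourierIntegrand (s : ℂ) (y ξ x : ℝ) {t : ℝ} (ht : 0 < t) :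
    ‖fourierIntegrand s y ξ x t‖ =
      t ^ (s.re - 1) * Real.exp (-(t * y ^ 2)) * Real.exp (-t * x ^ 2) := by
  rw [fourierIntegrand, norm_mul, norm_mul, Complex.norm_exp_ofReal_mul_I,
    Complex.norm_cpow_eq_rpow_re_of_pos ht, Complex.norm_real, Real.norm_of_nonneg (Real.exp_nonneg _),
    one_mul, mul_assoc, ← Real.exp_add]
  simp only [Complex.sub_re, Complex.one_re]
  ring_nf

theorem measurable_fourierIntegrand (s : ℂ) (y ξ : ℝ) :
    Measurable (Function.uncurry (fourierIntegrand s y ξ)) := by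
  unfold fourierIntegrand Function.uncurry
  have h1 : Measurable fun a : ℝ × ℝ => (a.2 : ℂ) ^ (s - 1) :=
    (measurable_ofReal_cpow (s - 1)).comp measurable_snd
  refine Measurable.mul (by fun_prop) (h1.mul (by fun_prop))

/-- The Gaussian integral in `x` costs `t^{-1/2}`, leaving `t^{Re s - 3/2} e^{-t y²}`, which is
integrable at `0` because `Re s > 1/2`. -/
theorem integrable_fourierIntegrand {s : ℂ} (hs : 1 / 2 < s.re) {y : ℝ} (hy : 0 < y) (ξ : ℝ) :
    Integrable (Function.uncurry (fourierIntegrand s y ξ))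
      (volume.prod (volume.restrict (Ioi (0 : ℝ)))) := by
  have hmeas := measurable_fourierIntegrand s y ξ
  rw [integrable_prod_iff' hmeas.aestronglyMeasurable]
  constructor
  · refine (ae_restrict_iff' measurableSet_Ioi).2 (Filter.Eventually.of_forall fun t ht => ?_)
    have ht : 0 < t := ht
    refine Integrable.mono' ((integrable_exp_neg_mul_sq ht).const_mul
      (t ^ (s.re - 1) * Real.exp (-(t * y ^ 2))))
      (hmeas.comp (measurable_id.prodMk measurable_const)).aestronglyMeasurable
      (Filter.Eventually.of_forall fun x => ?_)
    exact (norm_fourierIntegrand s y ξ x ht).le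
  · have h := (integrableOn_rpow_mul_exp (a := s.re - 3 / 2) (by linarith)
      (sq_pos_of_pos hy)).const_mul (√Real.pi)
    refine IntegrableOn.congr_fun h (fun t ht => ?_) measurableSet_Ioi
    have ht : 0 < t := ht
    simp only [Function.uncurry]
    simp_rw [norm_fourierIntegrand s y ξ _ ht]
    rw [integral_const_mul, integral_gaussian, Real.sqrt_div Real.pi_pos.le]
    rw [show s.re - 1 = (s.re - 3 / 2) + 1 / 2 by ring, Real.rpow_add ht, ← Real.sqrt_eq_rpow]
    have : √t ≠ 0 := (Real.sqrt_pos.2 ht).ne'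
    field_simp

/-- Write `Γ(s) r^{-s} = ∫ t^{s-1} e^{-rt} dt` with `r = x² + y²` and apply Fubini; the integral in
`x` is the Fourier transform of a Gaussian. -/
theorem fourier_sqAddSqCpow {s : ℂ} (hs : 1 / 2 < s.re) {y : ℝ} (hy : 0 < y) (ξ : ℝ) :
    𝓕 (sqAddSqCpow s y) ξ =
      (Real.pi : ℂ) ^ (1 / 2 : ℂ) / Complex.Gamma s * besselIntegral s y ξ := by
  have hs0 : 0 < s.re := by linarith
  have hG : Complex.Gamma s ≠ 0 := Complex.Gamma_ne_zero_of_re_pos hs0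
  rw [div_mul_eq_mul_div, eq_div_iff hG, Real.fourier_real_eq_integral_exp_smul, ← integral_mul_const]
  have h1 : ∀ x : ℝ, Complex.exp (((-2 * Real.pi * x * ξ : ℝ) : ℂ) * Complex.I) • sqAddSqCpow s y x *
      Complex.Gamma s = ∫ t in Ioi (0 : ℝ), fourierIntegrand s y ξ x t := by
    intro x
    have hr : 0 < x ^ 2 + y ^ 2 := by positivity
    have := Complex.integral_cpow_mul_exp_neg_mul_Ioi hs0 hr
    unfold fourierIntegrand
    rw [integral_const_mul, smul_eq_mul, mul_assoc]
    congr 1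
    rw [sqAddSqCpow, Complex.cpow_neg, ← Complex.inv_cpow, ← one_div, ← this]
    · refine setIntegral_congr_fun measurableSet_Ioi fun t _ => ?_
      push_cast
      rw [mul_comm (t : ℂ) ((x : ℂ) ^ 2 + _)]
    · rw [Complex.arg_ofReal_of_nonneg hr.le]
      exact Real.pi_pos.ne
  simp_rw [h1]
  rw [integral_integral_swap (integrable_fourierIntegrand hs hy ξ), besselIntegral,
    ← integral_const_mul]
  refine setIntegral_congr_fun measurableSet_Ioi fun t ht => ?_
  have ht : 0 < t := ht
  have ht0 : (t : ℂ) ≠ 0 := by exact_mod_cast ht.ne'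
  have hgauss := fourierIntegral_gaussian (b := (t : ℂ)) (by simpa using ht) (-2 * Real.pi * ξ)
  have h2 : ∀ x : ℝ, fourierIntegrand s y ξ x t =
      ((t : ℂ) ^ (s - 1) * (Real.exp (-(t * y ^ 2)) : ℂ)) *
      (Complex.exp (Complex.I * (-2 * Real.pi * ξ) * x) * Complex.exp (-(t : ℂ) * (x : ℂ) ^ 2)) := by
    intro x
    rw [fourierIntegrand, show -(t * (x ^ 2 + y ^ 2)) = -(t * y ^ 2) + -t * x ^ 2 by ring,
      Real.exp_add]
    push_cast
    rw [show (-2 * (Real.pi : ℂ) * x * ξ) * Complex.I = Complex.I * (-2 * Real.pi * ξ) * x by ring]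
    ring
  simp_rw [h2]
  rw [integral_const_mul, hgauss, Complex.div_cpow_ofReal_nonneg Real.pi_pos.le ht.le]
  rw [show s - 1 = (s - 3 / 2) + 1 / 2 by ring, Complex.cpow_add _ _ ht0]
  have h3 : (t : ℂ) ^ (1 / 2 : ℂ) ≠ 0 := by simp [Complex.cpow_eq_zero_iff, ht0]
  rw [neg_add, Real.exp_add]
  have h4 : Complex.exp (-(-2 * (Real.pi : ℂ) * ξ) ^ 2 / (4 * t)) =
      (Real.exp (-(Real.pi ^ 2 * ξ ^ 2 / t)) : ℂ) := by
    push_cast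
    congr 1
    field_simp
    ring
  rw [h4]
  push_cast
  field_simp

theorem besselIntegral_zero {s : ℂ} (hs : 1 / 2 < s.re) {y : ℝ} (hy : 0 < y) :
    besselIntegral s y 0 = (y : ℂ) ^ (1 - 2 * s) * Complex.Gamma (s - 1 / 2) := by
  have hy2 : 0 < y ^ 2 := by positivity
  have hy0 : (y : ℂ) ≠ 0 := by exact_mod_cast hy.ne'
  have := Complex.integral_cpow_mul_exp_neg_mul_Ioi (a := s - 1 / 2) (by simp; linarith) hy2
  have h1 : (1 / ((y ^ 2 : ℝ) : ℂ)) ^ (s - 1 / 2) = (y : ℂ) ^ (1 - 2 * s) := by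
    rw [one_div, Complex.inv_cpow, ← Complex.cpow_neg, Complex.ofReal_pow, sq,
      Complex.mul_cpow_ofReal_nonneg hy.le hy.le, ← Complex.cpow_add _ _ hy0]
    · ring_nf
    · rw [Complex.arg_ofReal_of_nonneg hy2.le]
      exact Real.pi_pos.ne
  rw [← h1, ← this, besselIntegral]
  refine setIntegral_congr_fun measurableSet_Ioi fun t _ => ?_
  rw [show s - 1 / 2 - 1 = s - 3 / 2 by ring]
  push_cast
  congr 2
  ring

/-- The substitution `t = cu` with `c = π|ξ|/y` balances the exponent: its two terms become `π|ξ|y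
u` and `π|ξ|y / u`. -/
theorem besselIntegral_eq_besselK (s : ℂ) {y ξ : ℝ} (hy : 0 < y) (hξ : ξ ≠ 0) :
    besselIntegral s y ξ = ((Real.pi * |ξ| / y : ℝ) : ℂ) ^ (s - 1 / 2) *
      (2 * besselK (s - 1 / 2) (2 * Real.pi * |ξ| * y)) := by
  have hξ' : 0 < |ξ| := abs_pos.2 hξ
  set c : ℝ := Real.pi * |ξ| / y with hc
  have hc0 : 0 < c := by positivity
  have hcC : (c : ℂ) ≠ 0 := by exact_mod_cast hc0.ne'
  have hsub := integral_comp_mul_left_Ioi (fun t : ℝ => (t : ℂ) ^ (s - 3 / 2) *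
    (Real.exp (-(t * y ^ 2 + Real.pi ^ 2 * ξ ^ 2 / t)) : ℂ)) 0 hc0
  rw [mul_zero] at hsub
  have h1 : besselIntegral s y ξ = (c : ℂ) * ∫ u in Ioi (0 : ℝ), ((c * u : ℝ) : ℂ) ^ (s - 3 / 2) *
      (Real.exp (-((c * u) * y ^ 2 + Real.pi ^ 2 * ξ ^ 2 / (c * u))) : ℂ) := by
    rw [hsub, besselIntegral, Complex.real_smul, Complex.ofReal_inv, ← mul_assoc,
      mul_inv_cancel₀ hcC, one_mul]
  rw [h1, besselK, ← mul_assoc 2, show (2 : ℂ) * (1 / 2) = 1 by norm_num, one_mul,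
    ← integral_const_mul, ← integral_const_mul]
  refine setIntegral_congr_fun measurableSet_Ioi fun u hu => ?_
  have hu : 0 < u := hu
  rw [Complex.ofReal_mul, Complex.mul_cpow_ofReal_nonneg hc0.le hu.le,
    show s - 1 / 2 = 1 + (s - 3 / 2) by ring, Complex.cpow_add _ _ hcC, Complex.cpow_one,
    show 1 + (s - 3 / 2) - 1 = s - 3 / 2 by ring]
  have h2 : -((c * u) * y ^ 2 + Real.pi ^ 2 * ξ ^ 2 / (c * u)) =
      -(2 * Real.pi * |ξ| * y / 2) * (u + 1 / u) := by
    rw [← sq_abs ξ, hc]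
    field_simp
  rw [h2]
  ring

/-- The inequality `e^{-a} ≤ 1/a` already gives decay `1/ξ²`, enough for summability over integer
frequencies. -/
theorem norm_besselIntegral_le {s : ℂ} (hs : 1 / 2 < s.re) {y ξ : ℝ} (hy : 0 < y) (hξ : ξ ≠ 0) :
    ‖besselIntegral s y ξ‖ ≤
      (∫ t in Ioi (0 : ℝ), t ^ (s.re - 1 / 2) * Real.exp (-(t * y ^ 2))) / (Real.pi ^ 2) *
        (1 / ξ ^ 2) := by
  have hint := integrableOn_rpow_mul_exp (a := s.re - 1 / 2) (by linarith) (sq_pos_of_pos hy)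
  rw [div_mul_eq_mul_div, mul_div_assoc, ← integral_mul_const]
  refine norm_integral_le_of_norm_le (hint.mul_const _) ?_
  refine (ae_restrict_iff' measurableSet_Ioi).2 (Filter.Eventually.of_forall fun t ht => ?_)
  have ht : 0 < t := ht
  have hξ2 : 0 < ξ ^ 2 := by positivity
  rw [norm_mul, Complex.norm_cpow_eq_rpow_re_of_pos ht, Complex.norm_real,
    Real.norm_of_nonneg (Real.exp_nonneg _), neg_add, Real.exp_add]
  set a : ℝ := Real.pi ^ 2 * ξ ^ 2 / t with ha
  have ha0 : 0 < a := by positivity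
  have h1 : Real.exp (-a) ≤ 1 / a := by
    rw [Real.exp_neg, ← one_div]
    exact one_div_le_one_div_of_le ha0 (by linarith [Real.add_one_le_exp a])
  have h2 : (s - 3 / 2).re = s.re - 3 / 2 := by simp
  rw [h2, show s.re - 1 / 2 = (s.re - 3 / 2) + 1 by ring, Real.rpow_add ht, Real.rpow_one]
  calc _ ≤ t ^ (s.re - 3 / 2) * (Real.exp (-(t * y ^ 2)) * (1 / a)) := by gcongr
    _ = _ := by rw [ha]; field_simp

theorem summable_fourier_sqAddSqCpow {s : ℂ} (hs : 1 / 2 < s.re) {y : ℝ} (hy : 0 < y) :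
    Summable fun m : ℤ => 𝓕 (sqAddSqCpow s y) (m : ℝ) := by
  have h2 : Summable fun n : ℤ => 1 / (n : ℝ) ^ 2 := Real.summable_one_div_int_pow.2 (by norm_num)
  refine Summable.of_norm_bounded_eventually (h2.mul_left
    (‖(Real.pi : ℂ) ^ (1 / 2 : ℂ) / Complex.Gamma s‖ *
    ((∫ t in Ioi (0 : ℝ), t ^ (s.re - 1 / 2) * Real.exp (-(t * y ^ 2))) / (Real.pi ^ 2)))) ?_
  -- The frequency `0` must be left out: there the majorant is `1 / 0 = 0`.
  filter_upwards [(Set.finite_singleton (0 : ℤ)).compl_mem_cofinite] with m hm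
  have hm0 : (m : ℝ) ≠ 0 := by exact_mod_cast hm
  rw [fourier_sqAddSqCpow hs hy, norm_mul, mul_assoc]
  exact mul_le_mul_of_nonneg_left (norm_besselIntegral_le hs hy hm0) (norm_nonneg _)

theorem continuous_sqAddSqCpow (s : ℂ) {y : ℝ} (hy : 0 < y) : Continuous (sqAddSqCpow s y) := by
  unfold sqAddSqCpow
  refine Continuous.cpow (by fun_prop) continuous_const fun x => ?_
  rw [Complex.ofReal_mem_slitPlane]
  positivity

theorem isBigO_sqAddSqCpow {s : ℂ} (hs : 0 < s.re) {y : ℝ} (hy : 0 < y) :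
    Asymptotics.IsBigO (Filter.cocompact ℝ) (sqAddSqCpow s y) fun x => |x| ^ (-(2 * s.re)) := by
  refine Asymptotics.IsBigO.of_bound 1 ?_
  filter_upwards [(isCompact_singleton (x := (0 : ℝ))).compl_mem_cocompact] with x hx
  have hx0 : 0 < |x| := abs_pos.2 hx
  have h1 : 0 < x ^ 2 + y ^ 2 := by positivity
  rw [sqAddSqCpow, Complex.norm_cpow_eq_rpow_re_of_pos h1, one_mul,
    Real.norm_of_nonneg (Real.rpow_nonneg hx0.le _), Complex.neg_re,
    show -(2 * s.re) = (2 : ℕ) * (-s.re) by push_cast; ring, Real.rpow_mul hx0.le, Real.rpow_natCast,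
    sq_abs]
  exact Real.rpow_le_rpow_of_nonpos (by rw [← sq_abs]; positivity) (by nlinarith) (by linarith)

/-- Poisson summation for `(x² + y²)^{-s}`. -/
theorem tsum_sqAddSqCpow {s : ℂ} (hs : 1 / 2 < s.re) {y : ℝ} (hy : 0 < y) (x : ℝ) :
    ∑' k : ℤ, sqAddSqCpow s y (x + k) =
      ∑' m : ℤ, 𝓕 (sqAddSqCpow s y) (m : ℝ) * Complex.exp (2 * Real.pi * Complex.I * m * x) := by
  rw [Real.tsum_eq_tsum_fourier_of_rpow_decay_of_summable (continuous_sqAddSqCpow s hy)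
    (b := 2 * s.re) (by linarith) (isBigO_sqAddSqCpow (by linarith) hy)
    (summable_fourier_sqAddSqCpow hs hy) x]
  refine tsum_congr fun m => ?_
  rw [fourier_coe_apply]
  simp

end Moonshine

/-! ### Cosets as coprime pairs, and absolute convergence. -/

namespace Moonshine

/-- The lower left entry of `δ γ⁻¹` is the determinant of the two lower rows, so a coset is a lower
row up to proportionality. -/
theorem rightRel_iff {N : ℕ} (γ δ : Gamma0Plus N) :
    QuotientGroup.rightRel (GammaInf N) γ δ ↔
      (δ : SL(2, ℝ)).1 1 0 * (γ : SL(2, ℝ)).1 1 1 = (δ : SL(2, ℝ)).1 1 1 * (γ : SL(2, ℝ)).1 1 0 := by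
  rw [QuotientGroup.rightRel_apply]
  have : δ * γ⁻¹ ∈ GammaInf N ↔ ((δ : SL(2, ℝ)) * (γ : SL(2, ℝ))⁻¹).1 1 0 = 0 := Iff.rfl
  rw [this, ← sub_eq_zero (a := (δ : SL(2, ℝ)).1 1 0 * _)]
  simp [Matrix.SpecialLinearGroup.coe_inv, Matrix.adjugate_fin_two, Matrix.mul_apply,
    Fin.sum_univ_two, sub_eq_add_neg]

/-- For squarefree `N`, `v = N/(N,q)` is coprime to `q`. Bézout for `q` and `v d` then supplies the
upper row of `v^{-1/2} (va, -b; Nn, vd)`, where `n = q/(N,q)` and `Nn = vq`. -/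
theorem exists_mem_Gamma0Plus_lower_row {N : ℕ} (hN : Squarefree N) {q : ℕ} (hq : 0 < q) {d : ℤ}
    (hd : IsCoprime (q : ℤ) d) : ∃ γ : Gamma0Plus N,
      (γ : SL(2, ℝ)).1 1 0 = √((N / N.gcd q : ℕ) : ℝ) * q ∧
      (γ : SL(2, ℝ)).1 1 1 = √((N / N.gcd q : ℕ) : ℝ) * d := by
  have hg : 0 < N.gcd q := Nat.gcd_pos_of_pos_right _ hq
  have hcop := Nat.coprime_div_gcd_div_gcd hg
  have hNg := Nat.div_mul_cancel (Nat.gcd_dvd_left N q)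
  have hqg := Nat.div_mul_cancel (Nat.gcd_dvd_right N q)
  set g := N.gcd q
  set v := N / g
  set n := q / g
  have hvpos : 0 < v := Nat.pos_of_ne_zero fun h => hN.ne_zero (by rw [← hNg, h, zero_mul])
  have hvg : Nat.Coprime v g := Nat.coprime_of_squarefree_mul (by rw [hNg]; exact hN)
  have hvq : Nat.Coprime v q := by
    rw [← hqg]
    exact hcop.mul_right hvg
  obtain ⟨b, a, hab⟩ : IsCoprime (q : ℤ) (v * d) :=
    (Nat.isCoprime_iff_coprime.2 hvq.symm).mul_right hd
  have hvR : (0 : ℝ) < v := by exact_mod_cast hvpos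
  have hsq : √(v : ℝ) * √(v : ℝ) = v := Real.mul_self_sqrt hvR.le
  have hs0 : √(v : ℝ) ≠ 0 := (Real.sqrt_pos.2 hvR).ne'
  have hdetZ : (v * a : ℤ) * (v * d) - (-b) * (N * n) = v := by
    have h1 : (N : ℤ) = v * g := by exact_mod_cast hNg.symm
    have h2 : (q : ℤ) = n * g := by exact_mod_cast hqg.symm
    rw [h1]
    rw [h2] at hab
    linear_combination (v : ℤ) * hab
  have hdetR : (v * a : ℝ) * (v * d) - (-b) * (N * n) = v := by exact_mod_cast hdetZ
  set M : Matrix (Fin 2) (Fin 2) ℝ := (√((v : ℤ) : ℝ))⁻¹ •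
    !![((v * a : ℤ) : ℝ), ((-b : ℤ) : ℝ); ((N * n : ℤ) : ℝ), ((v * d : ℤ) : ℝ)] with hM
  have hdet : M.det = 1 := by
    rw [hM, Matrix.det_smul, Matrix.det_fin_two_of, Fintype.card_fin]
    push_cast
    rw [hdetR, inv_pow, sq, hsq, inv_mul_cancel₀ hvR.ne']
  refine ⟨⟨⟨M, hdet⟩, v * a, -b, N * n, v * d, v, by exact_mod_cast hvpos, hdetZ, ?_,
    Dvd.intro _ rfl, Dvd.intro _ rfl, Dvd.intro _ rfl, rfl⟩, ?_, ?_⟩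
  · exact_mod_cast Dvd.intro _ hNg
  · have h1 : (N : ℝ) = v * g := by exact_mod_cast hNg.symm
    have h2 : (q : ℝ) = n * g := by exact_mod_cast hqg.symm
    simp only [hM, Matrix.smul_apply, Matrix.of_apply, Matrix.cons_val', Matrix.cons_val_zero,
      Matrix.cons_val_one, smul_eq_mul]
    push_cast
    rw [h1, h2]
    field_simp
    rw [sq, hsq]
  · simp only [hM, Matrix.smul_apply, Matrix.of_apply, Matrix.cons_val', Matrix.cons_val_one,
      smul_eq_mul]
    push_cast
    field_simp
    rw [sq, hsq]

/-- The coprime pairs `(q, d)` with `q > 0`. -/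
abbrev CoprimePair : Type := {p : ℕ × ℤ // 0 < p.1 ∧ IsCoprime (p.1 : ℤ) p.2}

/-- A matrix in `Γ₀(N)⁺` whose lower row is proportional to the given coprime pair. -/
noncomputable def lowerRowRep {N : ℕ} (hN : Squarefree N) (p : CoprimePair) : Gamma0Plus N :=
  (exists_mem_Gamma0Plus_lower_row hN p.2.1 p.2.2).choose

theorem lowerRowRep_one_zero {N : ℕ} (hN : Squarefree N) (p : CoprimePair) :
    (lowerRowRep hN p : SL(2, ℝ)).1 1 0 = √((N / N.gcd p.1.1 : ℕ) : ℝ) * p.1.1 :=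
  (exists_mem_Gamma0Plus_lower_row hN p.2.1 p.2.2).choose_spec.1

theorem lowerRowRep_one_one {N : ℕ} (hN : Squarefree N) (p : CoprimePair) :
    (lowerRowRep hN p : SL(2, ℝ)).1 1 1 = √((N / N.gcd p.1.1 : ℕ) : ℝ) * p.1.2 :=
  (exists_mem_Gamma0Plus_lower_row hN p.2.1 p.2.2).choose_spec.2

theorem sqrt_div_gcd_pos {N : ℕ} (hN : N ≠ 0) (q : ℕ) : 0 < √((N / N.gcd q : ℕ) : ℝ) := by
  refine Real.sqrt_pos.2 ?_
  exact_mod_cast Nat.div_pos (Nat.le_of_dvd hN.bot_lt (Nat.gcd_dvd_left N q))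
    (Nat.gcd_pos_of_pos_left _ hN.bot_lt)

/-- The parametrization of the cosets by the trivial coset and the coprime pairs. -/
noncomputable def cosetOfIndex {N : ℕ} (hN : Squarefree N) : Unit ⊕ CoprimePair → Cosets N :=
  Sum.elim (fun _ => Quotient.mk _ 1) (fun p => Quotient.mk _ (lowerRowRep hN p))

theorem coprimePair_eq_of_mul_eq {p r : CoprimePair}
    (h : (p.1.1 : ℤ) * r.1.2 = p.1.2 * r.1.1) : p = r := by
  obtain ⟨⟨q, d⟩, hq, hqd⟩ := p
  obtain ⟨⟨k, e⟩, hk, hke⟩ := r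
  simp only at h hq hqd hk hke
  have h1 : (q : ℤ) ∣ k := hqd.dvd_of_dvd_mul_left ⟨e, h.symm⟩
  have h2 : (k : ℤ) ∣ q := hke.dvd_of_dvd_mul_right ⟨d, by rw [h]; ring⟩
  have hqk : q = k := Nat.dvd_antisymm (by exact_mod_cast h1) (by exact_mod_cast h2)
  subst hqk
  have hq0 : (q : ℤ) ≠ 0 := by exact_mod_cast hq.ne'
  have : d = e := mul_left_cancel₀ hq0 (by rw [h]; ring)
  subst this
  rfl

theorem cosetOfIndex_injective {N : ℕ} (hN : Squarefree N) :
    Function.Injective (cosetOfIndex hN) := by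
  have h0 : ∀ p : CoprimePair, (lowerRowRep hN p : SL(2, ℝ)).1 1 0 ≠ 0 := by
    intro p
    rw [lowerRowRep_one_zero]
    exact mul_ne_zero (sqrt_div_gcd_pos hN.ne_zero _).ne' (by exact_mod_cast p.2.1.ne')
  rintro (_ | p) (_ | r) h
  · rfl
  · have := (rightRel_iff _ _).1 (Quotient.exact h)
    simp at this
    exact absurd this (h0 r)
  · have := (rightRel_iff _ _).1 (Quotient.exact h)
    simp at this
    exact absurd this.symm (h0 p)
  · congr 1
    have := (rightRel_iff _ _).1 (Quotient.exact h)
    rw [lowerRowRep_one_zero, lowerRowRep_one_one, lowerRowRep_one_zero, lowerRowRep_one_one] at this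
    have hp := (sqrt_div_gcd_pos hN.ne_zero p.1.1).ne'
    have hr := (sqrt_div_gcd_pos hN.ne_zero r.1.1).ne'
    have h3 : (r.1.1 : ℝ) * p.1.2 = r.1.2 * p.1.1 := by
      apply mul_left_cancel₀ (mul_ne_zero hp hr)
      linear_combination this
    exact (coprimePair_eq_of_mul_eq (by exact_mod_cast h3)).symm

theorem cosetOfIndex_surjective {N : ℕ} (hN : Squarefree N) :
    Function.Surjective (cosetOfIndex hN) := by
  intro x
  induction x using Quotient.inductionOn with
  | h γ =>
    obtain ⟨a, b, c, d, e, he, hdet, ⟨f, hf⟩, ⟨a', ha⟩, ⟨d', hd⟩, ⟨c', hc⟩, hm⟩ := γ.2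
    have heR : (0 : ℝ) < √(e : ℝ) := Real.sqrt_pos.2 (by exact_mod_cast he)
    have hγ0 : (γ : SL(2, ℝ)).1 1 0 = (√(e : ℝ))⁻¹ * c := by rw [hm]; simp
    have hγ1 : (γ : SL(2, ℝ)).1 1 1 = (√(e : ℝ))⁻¹ * d := by rw [hm]; simp
    by_cases hc0 : c = 0
    · refine ⟨Sum.inl (), Quotient.sound ((rightRel_iff _ _).2 ?_)⟩
      simp [hγ0, hc0]
    -- Dividing the determinant relation by `e` makes `(f c', d')` coprime. The sign `σ` makes its
    -- first entry positive. Proportional rows suffice, so `e` need not be compared with `N/(N,q)`.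
    · have hcop : e * a' * d' - b * (f * c') = 1 := by
        apply mul_left_cancel₀ he.ne'
        calc _ = (e * a') * (e * d') - b * ((e * f) * c') := by ring
          _ = e * 1 := by rw [← ha, ← hd, ← hf, ← hc, hdet, mul_one]
      have hfc : f * c' ≠ 0 := by
        intro h
        apply hc0
        rw [hc, hf, mul_assoc, h, mul_zero]
      obtain ⟨σ, hσ, hσabs⟩ : ∃ σ : ℤ, σ * σ = 1 ∧ ((f * c').natAbs : ℤ) = σ * (f * c') := by
        rcases Int.natAbs_eq (f * c') with h | h
        · exact ⟨1, by norm_num, by linarith⟩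
        · exact ⟨-1, by norm_num, by linarith⟩
      have hσR : (((f * c').natAbs : ℕ) : ℝ) = σ * (f * c') := by
        rw [← Int.cast_natCast, hσabs]
        push_cast
        ring
      refine ⟨Sum.inr ⟨((f * c').natAbs, σ * d'), Int.natAbs_pos.2 hfc, ?_⟩, ?_⟩
      · refine ⟨-(σ * b), σ * e * a', ?_⟩
        simp only
        rw [hσabs]
        linear_combination hcop + (-(b * (f * c')) + e * a' * d') * hσ
      · refine Quotient.sound ((rightRel_iff _ _).2 ?_)
        rw [lowerRowRep_one_zero, lowerRowRep_one_one, hγ0, hγ1]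
        simp only
        rw [hσR, hc, hd, hf]
        push_cast
        ring

theorem cosetOfIndex_bijective {N : ℕ} (hN : Squarefree N) :
    Function.Bijective (cosetOfIndex hN) :=
  ⟨cosetOfIndex_injective hN, cosetOfIndex_surjective hN⟩

theorem im_specialLinearGroup_smul (A : SL(2, ℝ)) (z : ℍ) :
    (A • z).im = z.im / Complex.normSq (A.1 1 0 * z + A.1 1 1) := by
  rw [MulAction.compHom_smul_def, UpperHalfPlane.im_smul_eq_div_normSq]
  simp [UpperHalfPlane.denom]

theorem eisensteinTerm_inl {N : ℕ} (hN : Squarefree N) (z : ℍ) (s : ℂ) :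
    eisensteinTerm N z s (cosetOfIndex hN (Sum.inl ())) = (z.im : ℂ) ^ s := by
  change ((((((1 : Gamma0Plus N) : SL(2, ℝ))) • z).im : ℝ) : ℂ) ^ s = _
  simp

theorem eisensteinTerm_inr {N : ℕ} (hN : Squarefree N) (z : ℍ) (s : ℂ) (p : CoprimePair) :
    eisensteinTerm N z s (cosetOfIndex hN (Sum.inr p)) =
      (z.im : ℂ) ^ s * ((N / N.gcd p.1.1 : ℕ) : ℂ) ^ (-s) *
        ((Complex.normSq (p.1.1 * z + p.1.2) : ℝ) : ℂ) ^ (-s) := by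
  change (((((lowerRowRep hN p : Gamma0Plus N) : SL(2, ℝ)) • z).im : ℝ) : ℂ) ^ s = _
  rw [im_specialLinearGroup_smul, lowerRowRep_one_zero, lowerRowRep_one_one]
  have hn : Complex.normSq (((√((N / N.gcd p.1.1 : ℕ) : ℝ) * p.1.1 : ℝ) : ℂ) * z +
      ((√((N / N.gcd p.1.1 : ℕ) : ℝ) * p.1.2 : ℝ) : ℂ)) =
      ((N / N.gcd p.1.1 : ℕ) : ℝ) * Complex.normSq (p.1.1 * z + p.1.2) := by
    have : ((√((N / N.gcd p.1.1 : ℕ) : ℝ) * p.1.1 : ℝ) : ℂ) * z +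
      ((√((N / N.gcd p.1.1 : ℕ) : ℝ) * p.1.2 : ℝ) : ℂ) =
      (√((N / N.gcd p.1.1 : ℕ) : ℝ) : ℂ) * (p.1.1 * z + p.1.2) := by
      push_cast
      ring
    rw [this, Complex.normSq_mul, Complex.normSq_ofReal, Real.mul_self_sqrt (Nat.cast_nonneg _)]
  rw [hn, Complex.ofReal_div, Complex.div_cpow_ofReal_nonneg z.im_pos.le
    (mul_nonneg (Nat.cast_nonneg _) (Complex.normSq_nonneg _)), Complex.ofReal_mul,
    Complex.mul_cpow_ofReal_nonneg (Nat.cast_nonneg _) (Complex.normSq_nonneg _),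
    Complex.cpow_neg, Complex.cpow_neg, div_eq_mul_inv, mul_inv, mul_assoc, Complex.ofReal_natCast]

theorem normSq_pos_of_coprimePair (z : ℍ) (p : CoprimePair) :
    0 < Complex.normSq (p.1.1 * z + p.1.2) := by
  rw [Complex.normSq_pos]
  intro h
  have := congrArg Complex.im h
  simp at this
  rcases this with h | h
  · exact p.2.1.ne' h
  · exact z.im_pos.ne' h

/-- The weight `(N/(N,q))^{-s}` has norm at most `1`, so the lattice sum over `ℤ²` with exponent `2
Re s > 2` dominates. -/
theorem summable_eisensteinTerm_inr {N : ℕ} (hN : Squarefree N) (z : ℍ) {s : ℂ} (hs : 1 < s.re) :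
    Summable fun p : CoprimePair => eisensteinTerm N z s (cosetOfIndex hN (Sum.inr p)) := by
  have hs2 : 2 < 2 * s.re := by linarith
  have hinj : Function.Injective fun p : CoprimePair => (![(p.1.1 : ℤ), p.1.2] : Fin 2 → ℤ) := by
    intro p r h
    have h0 := congrFun h 0
    have h1 := congrFun h 1
    simp at h0 h1
    exact Subtype.ext (Prod.ext h0 h1)
  have hsum := (((EisensteinSeries.summable_one_div_norm_rpow hs2).comp_injective hinj).mul_left
    (EisensteinSeries.r z ^ (-(2 * s.re)))).mul_left (z.im ^ s.re)
  refine Summable.of_norm_bounded hsum fun p => ?_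
  have hb := EisensteinSeries.summand_bound z (k := 2 * s.re) (by linarith) ![(p.1.1 : ℤ), p.1.2]
  have hpos := normSq_pos_of_coprimePair z p
  rw [eisensteinTerm_inr, norm_mul, norm_mul, Complex.norm_cpow_eq_rpow_re_of_pos z.im_pos,
    Complex.norm_cpow_eq_rpow_re_of_pos hpos, mul_assoc]
  refine mul_le_mul_of_nonneg_left ?_ (Real.rpow_nonneg z.im_pos.le _)
  simp only [Matrix.cons_val_zero, Matrix.cons_val_one, Int.cast_natCast] at hb
  have h2 : Complex.normSq (p.1.1 * z + p.1.2) ^ (-s).re =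
      ‖(p.1.1 : ℂ) * z + p.1.2‖ ^ (-(2 * s.re)) := by
    rw [Complex.normSq_eq_norm_sq, ← Real.rpow_natCast, ← Real.rpow_mul (norm_nonneg _)]
    congr 1
    simp
  rw [h2]
  calc _ ≤ 1 * ‖(p.1.1 : ℂ) * z + p.1.2‖ ^ (-(2 * s.re)) :=
        mul_le_mul_of_nonneg_right (norm_natCast_cpow_neg_le_one _ (by linarith))
          (Real.rpow_nonneg (norm_nonneg _) _)
    _ ≤ _ := by rw [one_mul]; exact hb

theorem summable_eisensteinTerm {N : ℕ} (hN : Squarefree N) (z : ℍ) {s : ℂ} (hs : 1 < s.re) :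
    Summable fun x : Cosets N => eisensteinTerm N z s x := by
  rw [← (Equiv.ofBijective _ (cosetOfIndex_bijective hN)).summable_iff]
  exact ((hasSum_fintype _).sum (f := fun i => eisensteinTerm N z s (cosetOfIndex hN i))
    (summable_eisensteinTerm_inr hN z hs).hasSum).summable

theorem eisenstein_eq_add_tsum {N : ℕ} (hN : Squarefree N) (z : ℍ) {s : ℂ} (hs : 1 < s.re) :
    eisenstein N z s = (z.im : ℂ) ^ s +
      ∑' p : CoprimePair, eisensteinTerm N z s (cosetOfIndex hN (Sum.inr p)) := by
  rw [eisenstein, ← (Equiv.ofBijective _ (cosetOfIndex_bijective hN)).tsum_eq]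
  have := ((hasSum_fintype _).sum (f := fun i => eisensteinTerm N z s (cosetOfIndex hN i))
    (summable_eisensteinTerm_inr hN z hs).hasSum).tsum_eq
  simpa [eisensteinTerm_inl] using this

end Moonshine

/-! ### Computation of the Fourier expansion. -/

namespace Moonshine

open FourierTransform

/-- The coprime pair `(q, u + q k)` attached to a reduced residue `u` modulo `q` and `k ∈ ℤ`. -/
noncomputable def residuePair (x : Σ q : ℕ+, (ZMod (q : ℕ))ˣ × ℤ) : CoprimePair :=
  ⟨(x.1, ((x.2.1 : ZMod (x.1 : ℕ)).val : ℤ) + (x.1 : ℕ) * x.2.2), x.1.pos,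
    (IsCoprime.add_mul_left_right
      (Nat.isCoprime_iff_coprime.2 (ZMod.val_coe_unit_coprime x.2.1).symm) _)⟩

theorem residuePair_bijective : Function.Bijective residuePair := by
  constructor
  · rintro ⟨q, u, k⟩ ⟨r, w, l⟩ h
    have h1 := congrArg (fun p : CoprimePair => p.1.1) h
    have h2 := congrArg (fun p : CoprimePair => p.1.2) h
    simp only [residuePair] at h1 h2
    obtain rfl := PNat.coe_injective h1
    have h3 := congrArg (fun t : ℤ => (t : ZMod (q : ℕ))) h2
    simp at h3
    obtain rfl := Units.ext h3
    have hq : ((q : ℕ) : ℤ) ≠ 0 := by exact_mod_cast q.pos.ne'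
    have : k = l := mul_left_cancel₀ hq (by linarith)
    rw [this]
  · rintro ⟨⟨q, d⟩, hq, hqd⟩
    simp only at hq hqd
    have : NeZero q := ⟨hq.ne'⟩
    obtain ⟨u, hu⟩ := (ZMod.coe_int_isUnit_iff_isCoprime d q).2 hqd
    have hdvd : (q : ℤ) ∣ d - ((u : ZMod q).val : ℤ) := by
      rw [← ZMod.intCast_eq_intCast_iff_dvd_sub]
      simp [hu]
    obtain ⟨k, hk⟩ := hdvd
    refine ⟨⟨⟨q, hq⟩, u, k⟩, Subtype.ext (Prod.ext rfl ?_)⟩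
    change ((u : ZMod q).val : ℤ) + q * k = d
    linarith

/-- This rests on `|qz + u + qk|² = q² ((x + u/q + k)² + y²)`; the sum over `k` becomes a
periodization. -/
theorem eisensteinTerm_residuePair {N : ℕ} (hN : Squarefree N) (z : ℍ) (s : ℂ) (q : ℕ+)
    (u : (ZMod (q : ℕ))ˣ) (k : ℤ) :
    eisensteinTerm N z s (cosetOfIndex hN (Sum.inr (residuePair ⟨q, u, k⟩))) =
      (z.im : ℂ) ^ s * ((N / N.gcd q : ℕ) : ℂ) ^ (-s) * (((q : ℕ) : ℂ) ^ (2 * s))⁻¹ *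
        sqAddSqCpow s z.im ((z.re + (u : ZMod (q : ℕ)).val / (q : ℕ)) + k) := by
  have hq : (0 : ℝ) < (q : ℕ) := by exact_mod_cast q.pos
  have hn : Complex.normSq (((q : ℕ) : ℂ) * z +
      ((((u : ZMod (q : ℕ)).val : ℤ) + (q : ℕ) * k : ℤ) : ℂ)) =
      (q : ℕ) * (q : ℕ) * (((z.re + (u : ZMod (q : ℕ)).val / (q : ℕ)) + k) ^ 2 + z.im ^ 2) := by
    generalize (u : ZMod (q : ℕ)).val = n
    rw [Complex.normSq_apply]
    simp
    field_simp
    ring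
  rw [eisensteinTerm_inr]
  simp only [residuePair]
  rw [hn, sqAddSqCpow, Complex.ofReal_mul, Complex.mul_cpow_ofReal_nonneg (by positivity)
    (by positivity), Complex.ofReal_mul, Complex.mul_cpow_ofReal_nonneg hq.le hq.le,
    Complex.ofReal_natCast, ← Complex.cpow_neg, ← Complex.cpow_add _ _ (by exact_mod_cast hq.ne'),
    mul_assoc, mul_assoc, mul_assoc]
  ring_nf

theorem exp_mul_ramanujanSum (q : ℕ) [NeZero q] (m : ℤ) (x : ℝ) :
    ∑ u : (ZMod q)ˣ, Complex.exp (2 * Real.pi * Complex.I * m * ((x + (u : ZMod q).val / q : ℝ) : ℂ))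
      = Complex.exp (2 * Real.pi * Complex.I * m * x) * ramanujanCoeff m q := by
  rw [← ramanujanSum_eq, ramanujanSum, Finset.mul_sum]
  refine Finset.sum_congr rfl fun u _ => ?_
  rw [← Complex.exp_nat_mul, ← Complex.exp_add]
  congr 1
  push_cast
  ring

theorem norm_exp_two_pi_I_mul (m : ℤ) (x : ℝ) :
    ‖Complex.exp (2 * Real.pi * Complex.I * m * x)‖ = 1 := by
  rw [show 2 * (Real.pi : ℂ) * Complex.I * m * x = ((2 * Real.pi * m * x : ℝ) : ℂ) * Complex.I
    by push_cast; ring]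
  exact Complex.norm_exp_ofReal_mul_I _

theorem summable_fourier_mul_exp {s : ℂ} (hs : 1 / 2 < s.re) {y : ℝ} (hy : 0 < y) (x : ℝ) :
    Summable fun m : ℤ =>
      𝓕 (sqAddSqCpow s y) (m : ℝ) * Complex.exp (2 * Real.pi * Complex.I * m * x) := by
  refine Summable.of_norm ((summable_fourier_sqAddSqCpow hs hy).norm.congr fun m => ?_)
  rw [norm_mul, norm_exp_two_pi_I_mul, mul_one]

/-- The bound on `mergedTerm` does not involve `m`, so a product of two convergent series in `q` and
`m` dominates. -/
theorem summable_fourier_mul_exp_mul_mergedTerm (N : ℕ) {s : ℂ} (hs : 1 < s.re) {y : ℝ}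
    (hy : 0 < y) (x : ℝ) : Summable fun p : ℕ × ℤ =>
      𝓕 (sqAddSqCpow s y) (p.2 : ℝ) * Complex.exp (2 * Real.pi * Complex.I * p.2 * x) *
        mergedTerm N p.2 s p.1 := by
  have h := (summable_natCast_rpow_one_sub hs).mul_of_nonneg
    (summable_fourier_sqAddSqCpow (s := s) (by linarith) hy).norm
    (fun q => Real.rpow_nonneg (Nat.cast_nonneg q) _) (fun _ => norm_nonneg _)
  refine Summable.of_norm_bounded h fun p => ?_
  rw [norm_mul, norm_mul, norm_exp_two_pi_I_mul, mul_one, mul_comm]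
  exact mul_le_mul_of_nonneg_right (norm_mergedTerm_le N _ hs _) (norm_nonneg _)

/-- For fixed `q`, Poisson summation handles `k` and the Ramanujan sum handles `u`; absolute
convergence of the double series then puts the sum over `q` inside. -/
theorem tsum_coprimePair {N : ℕ} (hN : Squarefree N) (z : ℍ) {s : ℂ} (hs : 1 < s.re) :
    ∑' p : CoprimePair, eisensteinTerm N z s (cosetOfIndex hN (Sum.inr p)) =
      (z.im : ℂ) ^ s * ∑' m : ℤ, 𝓕 (sqAddSqCpow s z.im) (m : ℝ) *
        Complex.exp (2 * Real.pi * Complex.I * m * z.re) * ∑' q, mergedTerm N m s q := by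
  have hs' : 1 / 2 < s.re := by linarith
  have hsum := summable_eisensteinTerm_inr hN z hs
  rw [← (Equiv.ofBijective _ residuePair_bijective).summable_iff] at hsum
  have hsum' : Summable fun x : (Σ q : ℕ+, (ZMod (q : ℕ))ˣ × ℤ) =>
      eisensteinTerm N z s (cosetOfIndex hN (Sum.inr (residuePair x))) := hsum
  rw [← (Equiv.ofBijective _ residuePair_bijective).tsum_eq]
  change ∑' x : (Σ q : ℕ+, (ZMod (q : ℕ))ˣ × ℤ),
      eisensteinTerm N z s (cosetOfIndex hN (Sum.inr (residuePair x))) = _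
  rw [hsum'.tsum_sigma]
  have hinner : ∀ q : ℕ+, ∑' p : (ZMod (q : ℕ))ˣ × ℤ,
      eisensteinTerm N z s (cosetOfIndex hN (Sum.inr (residuePair ⟨q, p⟩))) =
      (z.im : ℂ) ^ s * ∑' m : ℤ, 𝓕 (sqAddSqCpow s z.im) (m : ℝ) *
        Complex.exp (2 * Real.pi * Complex.I * m * z.re) * mergedTerm N m s q := by
    intro q
    rw [(hsum'.sigma_factor q).tsum_prod, tsum_fintype]
    simp_rw [eisensteinTerm_residuePair, tsum_mul_left, tsum_sqAddSqCpow hs' z.im_pos]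
    rw [← Finset.mul_sum, ← Summable.tsum_finsetSum
      (fun u _ => summable_fourier_mul_exp hs' z.im_pos _), mul_assoc, mul_assoc, ← mul_assoc
      (((N / N.gcd q : ℕ) : ℂ) ^ (-s)), ← tsum_mul_left]
    congr 1
    refine tsum_congr fun m => ?_
    rw [← Finset.mul_sum, exp_mul_ramanujanSum, mergedTerm]
    ring
  simp_rw [hinner]
  rw [tsum_mul_left]
  congr 1
  have hdouble := summable_fourier_mul_exp_mul_mergedTerm N hs z.im_pos z.re
  have hzero : ∀ m : ℤ, mergedTerm N m s 0 = 0 := by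
    intro m
    have := norm_mergedTerm_le N m hs 0
    rw [Nat.cast_zero, Real.zero_rpow (by linarith)] at this
    exact norm_le_zero_iff.1 this
  have hsupp : Function.support (fun q : ℕ => ∑' m : ℤ, 𝓕 (sqAddSqCpow s z.im) (m : ℝ) *
      Complex.exp (2 * Real.pi * Complex.I * m * z.re) * mergedTerm N m s q) ⊆
      Set.range ((↑) : ℕ+ → ℕ) := by
    intro q hq
    refine ⟨⟨q, Nat.pos_of_ne_zero ?_⟩, rfl⟩
    rintro rfl
    apply hq
    simp only [hzero, mul_zero, tsum_zero]
  refine (PNat.coe_injective.tsum_eq hsupp).trans ?_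
  refine (Summable.tsum_comm (f := fun (q : ℕ) (m : ℤ) => 𝓕 (sqAddSqCpow s z.im) (m : ℝ) *
    Complex.exp (2 * Real.pi * Complex.I * m * z.re) * mergedTerm N m s q) hdouble).symm.trans ?_
  exact tsum_congr fun m => tsum_mul_left

theorem summable_fourier_mul_tsum {N : ℕ} {s : ℂ} (hs : 1 < s.re) {y : ℝ} (hy : 0 < y) (x : ℝ) :
    Summable fun m : ℤ => 𝓕 (sqAddSqCpow s y) (m : ℝ) *
      Complex.exp (2 * Real.pi * Complex.I * m * x) * ∑' q, mergedTerm N m s q := by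
  have h := (summable_fourier_mul_exp_mul_mergedTerm N hs hy x).prod_symm.prod
  refine h.congr fun m => ?_
  rw [← tsum_mul_left]
  rfl

/-- The polynomial factors of the two `ξ` values have quotient `(s-1)/s`, cancelling `s/(s-1)`; the
powers of `π` leave `π^{1/2}`. -/
theorem scattering_eq (N : ℕ) {s : ℂ} (hs : 1 < s.re) :
    scattering N s = (Real.pi : ℂ) ^ (1 / 2 : ℂ) / Complex.Gamma s * Complex.Gamma (s - 1 / 2) *
      (riemannZeta (2 * s - 1) / riemannZeta (2 * s) *
        ∏ p ∈ N.primeFactors, ((p : ℂ) ^ (1 - s) + 1) / ((p : ℂ) ^ s + 1)) := by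
  have hne : ∀ w : ℂ, 0 < w.re → w ≠ 0 := by
    rintro w hw rfl
    simp at hw
  have h0 : s ≠ 0 := hne s (by linarith)
  have h1 : s - 1 ≠ 0 := hne _ (by simp; linarith)
  have h2 : 2 * s - 1 ≠ 0 := hne _ (by simp; linarith)
  have hpi : (Real.pi : ℂ) ≠ 0 := by exact_mod_cast Real.pi_pos.ne'
  have hG : Complex.Gamma s ≠ 0 := Complex.Gamma_ne_zero_of_re_pos (by linarith)
  have hz : riemannZeta (2 * s) ≠ 0 := riemannZeta_ne_zero_of_one_lt_re (by simp; linarith)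
  have hps : (Real.pi : ℂ) ^ (-s) ≠ 0 := by simp [Complex.cpow_eq_zero_iff, hpi]
  have e1 : (Real.pi : ℂ) ^ (-(2 * s - 1) / 2) =
      (Real.pi : ℂ) ^ (-s) * (Real.pi : ℂ) ^ (1 / 2 : ℂ) := by
    rw [← Complex.cpow_add _ _ hpi]
    ring_nf
  have e2 : (2 * s - 1) / 2 = s - 1 / 2 := by ring
  have e3 : -(2 * s) / 2 = -s := by ring
  have e4 : 2 * s / 2 = s := by ring
  rw [scattering, xi, xi, e1, e2, e3, e4, ← mul_assoc _ (riemannZeta (2 * s - 1) / _)]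
  congr 1
  rw [show 2 * s - 1 - 1 = 2 * (s - 1) by ring]
  generalize Complex.Gamma (s - 1 / 2) = G
  generalize riemannZeta (2 * s) = Z at hz ⊢
  generalize riemannZeta (2 * s - 1) = Z'
  generalize 2 * s - 1 = w at h2 ⊢
  field_simp

theorem cpow_mul_fourier_zero_mul_tsum {N : ℕ} (hN : Squarefree N) {s : ℂ} (hs : 1 < s.re) {y : ℝ}
    (hy : 0 < y) :
    (y : ℂ) ^ s * (𝓕 (sqAddSqCpow s y) 0 * ∑' q, mergedTerm N 0 s q) =
      scattering N s * (y : ℂ) ^ (1 - s) := by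
  have hy0 : (y : ℂ) ≠ 0 := by exact_mod_cast hy.ne'
  rw [fourier_sqAddSqCpow (by linarith) hy, besselIntegral_zero (by linarith) hy,
    tsum_mergedTerm_zero hN hs, scattering_eq N hs, show 1 - s = s + (1 - 2 * s) by ring,
    Complex.cpow_add s _ hy0]
  ring

theorem cpow_mul_fourier_mul_tsum {N : ℕ} (hN : Squarefree N) {s : ℂ} (hs : 1 < s.re) (z : ℍ)
    {m : ℤ} (hm : m ≠ 0) :
    (z.im : ℂ) ^ s * (𝓕 (sqAddSqCpow s z.im) (m : ℝ) *
        Complex.exp (2 * Real.pi * Complex.I * m * z.re) * ∑' q, mergedTerm N m s q) =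
      fourierCoeff N m s * whittaker s m z := by
  have hmR : (m : ℝ) ≠ 0 := by exact_mod_cast hm
  have hy := z.im_pos
  have hy0 : (z.im : ℂ) ≠ 0 := by exact_mod_cast hy.ne'
  have hm0 : 0 < |(m : ℝ)| := abs_pos.2 hmR
  have hmC : ((|(m : ℝ)| : ℝ) : ℂ) ≠ 0 := by exact_mod_cast hm0.ne'
  have hpi : (Real.pi : ℂ) ≠ 0 := by exact_mod_cast Real.pi_pos.ne'
  have habs : (((|m| : ℤ)) : ℂ) = ((|(m : ℝ)| : ℝ) : ℂ) := by
    rw [← Int.cast_abs, Complex.ofReal_intCast]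
  have hsqrt : ((√(|(m : ℝ)| * z.im) : ℝ) : ℂ) =
      ((|(m : ℝ)| : ℝ) : ℂ) ^ (1 / 2 : ℂ) * (z.im : ℂ) ^ (1 / 2 : ℂ) := by
    rw [Real.sqrt_eq_rpow, Complex.ofReal_cpow (by positivity), Complex.ofReal_mul,
      Complex.mul_cpow_ofReal_nonneg hm0.le hy.le]
    norm_num
  rw [fourier_sqAddSqCpow (by linarith) hy, besselIntegral_eq_besselK s hy hmR, fourierCoeff,
    sum_divisors_dirichletTerm hN m hs, whittaker, habs, hsqrt, Complex.ofReal_div,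
    Complex.ofReal_mul, ← Complex.ofReal_mul, Complex.div_cpow_ofReal_nonneg (by positivity) hy.le,
    Complex.ofReal_mul, Complex.mul_cpow_ofReal_nonneg Real.pi_pos.le hm0.le]
  -- The powers are split so as to match `y^s π^{1/2} (π|m|/y)^{s-1/2} = π^s |m|^{s-1} √(|m| y)`.
  have e1 : (Real.pi : ℂ) ^ s = (Real.pi : ℂ) ^ (1 / 2 : ℂ) * (Real.pi : ℂ) ^ (s - 1 / 2) := by
    rw [← Complex.cpow_add _ _ hpi]; ring_nf
  have e2 : ((|(m : ℝ)| : ℝ) : ℂ) ^ (s - 1 / 2) =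
      ((|(m : ℝ)| : ℝ) : ℂ) ^ (s - 1) * ((|(m : ℝ)| : ℝ) : ℂ) ^ (1 / 2 : ℂ) := by
    rw [← Complex.cpow_add _ _ hmC]; ring_nf
  have e3 : (z.im : ℂ) ^ s = (z.im : ℂ) ^ (1 / 2 : ℂ) * (z.im : ℂ) ^ (s - 1 / 2) := by
    rw [← Complex.cpow_add _ _ hy0]; ring_nf
  have hys : (z.im : ℂ) ^ (s - 1 / 2) ≠ 0 := by simp [Complex.cpow_eq_zero_iff, hy0]
  have e4 : Complex.exp (2 * Real.pi * Complex.I * m * z.re) =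
      Complex.exp (2 * Real.pi * Complex.I * (m * z.re)) := by rw [mul_assoc]
  rw [e1, e2, e3, e4]
  generalize (z.im : ℂ) ^ (s - 1 / 2) = Y at hys ⊢
  field_simp

theorem tsum_int_eq_zero_add {f : ℤ → ℂ} (hf : Summable f) :
    ∑' m, f m = f 0 + ∑' m : {m : ℤ // m ≠ 0}, f m := by
  rw [← hf.tsum_subtype_add_tsum_subtype_compl {0}, tsum_singleton]
  rfl

end Moonshine

open Moonshine in
theorem lemma4p1 (N : ℕ) (hN : Squarefree N) (s : ℂ) (hs : 1 < s.re) :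
    (∀ z : UpperHalfPlane, Summable (fun q : Cosets N => eisensteinTerm N z s q)) ∧
    (∀ m : ℤ, m ≠ 0 → ∀ v ∈ N.divisors,
      Summable (fun n : {n : ℕ // 1 ≤ n ∧ Nat.Coprime v n} => dirichletTerm N m s v n)) ∧
    (∀ z : UpperHalfPlane,
      Summable (fun m : {m : ℤ // m ≠ 0} => fourierCoeff N m s * whittaker s m z) ∧
      eisenstein N z s =
        (z.im : ℂ) ^ s + scattering N s * (z.im : ℂ) ^ (1 - s) +
          ∑' m : {m : ℤ // m ≠ 0}, fourierCoeff N m s * whittaker s m z) := by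
  refine ⟨fun z => summable_eisensteinTerm hN z hs,
    fun m _ v hv => summable_dirichletTerm N hN m hs hv, fun z => ?_⟩
  -- Summability over all frequencies serves twice: it restricts to `m ≠ 0`, and it lets the term `m
  -- = 0` be split off as the scattering term.
  have hG := (summable_fourier_mul_tsum (N := N) hs z.im_pos z.re).mul_left ((z.im : ℂ) ^ s)
  have hterm : ∀ m : {m : ℤ // m ≠ 0}, _ := fun m => cpow_mul_fourier_mul_tsum hN hs z m.2
  have hne := hG.comp_injective (Subtype.val_injective (p := fun m : ℤ => m ≠ 0))
  simp only [Function.comp_def, hterm] at hne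
  refine ⟨hne, ?_⟩
  rw [eisenstein_eq_add_tsum hN z hs, tsum_coprimePair hN z hs, add_assoc, ← tsum_mul_left]
  congr 1
  rw [tsum_int_eq_zero_add hG]
  congr 1
  · rw [← cpow_mul_fourier_zero_mul_tsum hN hs z.im_pos]
    simp
  · exact tsum_congr hterm
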